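/- Let $n,k,d\ge 1$ be integers and, for $\theta\in[0,1]^d$, let $P_\theta=\prod_{i=1}^d \mathsf{Bern}(\theta_i)$ on $\{0,1\}^d$. Let $X_1,\dots,X_n$ be i.i.d. from $P_\theta$, with $X_i$ held by sensor $i$. In a ($k$-bit) blackboard protocol the sensors write bits, one at a time, on a board that everybody sees. The bits written so far determine which sensor writes next, and the bit it writes is a function of its own sample and of the bits written so far. Each sensor writes exactly $k$ bits, so the final transcript $Y$ is a string of $nk$ bits. The protocol may be chosen at random, independently of the samples, by public randomness from an arbitrary probability space. An estimator $\hat\theta$, with values in $\mathbb{R}^d$, is a function of $Y$. For $\Theta\subseteq[0,1]^d$ let $$R_{n,k}(\Theta)=\inf_{\text{protocols}}\ \inf_{\hat\theta}\ \sup_{\theta\in\Theta}\ \mathbb{E}_\theta\|\hat\theta-\theta\|_2^2 .$$ There are universal constants $0<c\le C<\infty$ (independent of $n,k,d$) such that the following hold. 1. For all $d\ge1$, $k\ge 1$ and $n\ge \frac{d^2}{\min(d,k)}$, $$c\,\max\Big(\frac{d^2}{nk},\frac dn\Big)\ \le\ R_{n,k}\big([0,1]^d\big)\ \le\ C\,\max\Big(\frac{d^2}{nk},\frac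 dn\Big).$$ 2. For all $d\ge2$, $k\ge 1$ and $n\ge \frac{d^2}{\min(d,2^k)}$, with $\Theta=\{\theta\in[0,1]^d:\sum_{i=1}^d\theta_i=1\}$, $$c\,\max\Big(\frac{d}{n2^k},\frac 1n\Big)\ \le\ R_{n,k}(\Theta)\ \le\ C\,\max\Big(\frac{d}{n2^k},\frac 1n\Big).$$ Both statements hold as well, with the same constants, if the estimator may depend on $Y$ and on the public randomness. -/

import Mathlib

open MeasureTheory ProbabilityTheory
open scoped ENNReal

noncomputable section

/-- A deterministic blackboard protocol for `n` sensors, each holding a sample in `X` and each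
allowed to write `k` bits: a complete binary tree of depth `n * k`, whose internal nodes are the
possible contents of the blackboard (bit strings of length `< n * k`). At the node `h` the sensor
`speaker h` writes the bit `bit h x`, where `x` is its own sample. On every root-to-leaf path, each
sensor speaks exactly `k` times. -/
structure BlackboardProtocol (n k : ℕ) (X : Type) where
  speaker : List Bool → Fin n
  bit : List Bool → X → Bool
  budget : ∀ y : List Bool, y.length = n * k → ∀ i : Fin n,
    ((Finset.range (n * k)).filter fun t => speaker (y.take t) = i).card = k

namespace BlackboardProtocol

variable {n k : ℕ} {X : Type}

/-- The content of the blackboard after `t` bits, when the samples of the sensors are `x`. -/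
def board (P : BlackboardProtocol n k X) (x : Fin n → X) : ℕ → List Bool
  | 0 => []
  | t + 1 => P.board x t ++ [P.bit (P.board x t) (x (P.speaker (P.board x t)))]

/-- The final transcript `Y`, a string of `n * k` bits. -/
def transcript (P : BlackboardProtocol n k X) (x : Fin n → X) : List Bool :=
  P.board x (n * k)

end BlackboardProtocol

/-- A blackboard protocol with public randomness: a random deterministic protocol, chosen
independently of the samples by a seed `ω` that lives on an arbitrary probability space.
Private randomness is the special case in which disjoint independent parts of the seed are used by
different sensors. -/
structure PublicCoinProtocol (n k : ℕ) (X : Type) where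
  Seed : Type
  [measurableSpaceSeed : MeasurableSpace Seed]
  law : Measure Seed
  [isProbabilityMeasure_law : IsProbabilityMeasure law]
  protocol : Seed → BlackboardProtocol n k X
  measurable_speaker : ∀ h, Measurable fun ω => (protocol ω).speaker h
  measurable_bit : ∀ h x, Measurable fun ω => (protocol ω).bit h x

attribute [instance] PublicCoinProtocol.measurableSpaceSeed
  PublicCoinProtocol.isProbabilityMeasure_law

/-- The product Bernoulli model `∏ j, Bern (θ j)` on `{0, 1}^d` (`true` stands for `1`). -/
def productBernoulli {d : ℕ} (θ : Fin d → unitInterval) : Measure (Fin d → Bool) :=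
  Measure.pi fun j => bernoulliMeasure true false (θ j)

/-- The squared Euclidean distance between an estimate and the parameter, as an extended
nonnegative real. -/
def squaredLoss {d : ℕ} (a : Fin d → ℝ) (θ : Fin d → unitInterval) : ℝ≥0∞ :=
  ENNReal.ofReal (∑ j, (a j - (θ j : ℝ)) ^ 2)

/-- The risk at `θ`: the expectation, over the public randomness and over `n` i.i.d. samples from
`productBernoulli θ`, one for each sensor, of the squared loss of the estimate. The estimator is a
function of the seed and of the transcript. -/
def blackboardRisk {n k d : ℕ} (P : PublicCoinProtocol n k (Fin d → Bool))
    (est : P.Seed → List Bool → Fin d → ℝ) (θ : Fin d → unitInterval) : ℝ≥0∞ :=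
  ∫⁻ ω, ∫⁻ x, squaredLoss (est ω ((P.protocol ω).transcript x)) θ
    ∂(Measure.pi fun _ : Fin n => productBernoulli θ) ∂P.law

/-- The minimax risk over `Θ`, for estimators that are functions of the transcript only. -/
def blackboardMinimaxRisk (n k : ℕ) {d : ℕ} (Θ : Set (Fin d → unitInterval)) : ℝ≥0∞ :=
  ⨅ (P : PublicCoinProtocol n k (Fin d → Bool)) (est : List Bool → Fin d → ℝ),
    ⨆ θ ∈ Θ, blackboardRisk P (fun _ => est) θ

/-- The minimax risk over `Θ`, for estimators that are functions of the transcript and of the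
public randomness. -/
def blackboardMinimaxRiskPublic (n k : ℕ) {d : ℕ} (Θ : Set (Fin d → unitInterval)) : ℝ≥0∞ :=
  ⨅ (P : PublicCoinProtocol n k (Fin d → Bool)) (est : P.Seed → List Bool → Fin d → ℝ)
    (_ : ∀ y, Measurable fun ω => est ω y),
    ⨆ θ ∈ Θ, blackboardRisk P est θ

/-- The parameters in `[0, 1]^d` whose coordinates sum to one. -/
def simplexParameters (d : ℕ) : Set (Fin d → unitInterval) :=
  {θ | ∑ j, (θ j : ℝ) = 1}

/-- `R` lies between `c * r` and `C * r`. -/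
def BetweenMultiples (c C r : ℝ) (R : ℝ≥0∞) : Prop :=
  ENNReal.ofReal (c * r) ≤ R ∧ R ≤ ENNReal.ofReal (C * r)

end

open MeasureTheory ProbabilityTheory
open scoped ENNReal

noncomputable section

/-! ### Expectations under finite product weights -/

section ProductWeights

variable {ι α : Type*} [Fintype ι] [DecidableEq ι]

/-! Lower bounds. For the uniform prior on a cube of parameters `u`, a van Trees inequality
(`vanTrees`) bounds the Bayes risk below by `m ^ 2 / (36 * (m + B))`, where `B` bounds the trace of
the Fisher information of the transcript. For a fixed seed, the samples that produce a given
transcript form a rectangle (`board_eq_iff`). So the samples stay independent given the transcript,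
and the information is a sum over the sensors (`fisherInfo_eq_sum`). Revealing all other samples can
only increase the share of one sensor; what is left is a partition of its sample space into at most
`2 ^ k` cells, however the order of speaking adapts (`card_transcripts_le`).

The information in such a partition is bounded in three ways: by that of the whole sample
(`fisherInfo_le_variance`), by the number of cells when the scores are orthogonal
(`sum_fisherInfo_le_card`), and by the logarithm of that number when they are sub-Gaussian
(`sum_fisherInfo_le_log`). With all `θ i` in `[1/4, 3/4]` the first and third give order `min d k`
per sensor. With all `θ i` of order `1 / d` the scores have variance of order `d`, and the first and
second give order `d * min d (2 ^ k)`. Averaging over the seed covers public randomness.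

Upper bounds. The sensors form nearly equal groups and write without interaction. On the cube, a
group sends `k` coordinates in the clear. On the simplex a sample has one `1` on average, so a group
takes a block of `2 ^ k - 1` coordinates and each sensor names the first `1` in its block, or
reports none. Later ones are censored, and `θ j` is estimated as a hazard rate: the sensors that
report `j` over those that reach `j`. Each block is visited in both directions; as the `θ i` sum to
one, some direction reaches `j` with probability at least one half (`half_le_survival`). With `B`
blocks the squared error at `j` is of order `θ j * B / n`, which sums to `B / n` without a factor
`d`. -/

theorem prod_update_mul (p : ι → α → ℝ) (x : ι → α) (i : ι) (a : α) :
    (∏ l, p l (Function.update x i a l)) * p i (x i) = (∏ l, p l (x l)) * p i a := by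
  have h (y : ι → α) : ∏ l, p l (y l) = p i (y i) * ∏ l ∈ Finset.univ.erase i, p l (y l) :=
    (Finset.mul_prod_erase _ (fun l => p l (y l)) (Finset.mem_univ i)).symm
  rw [h, h x, Function.update_self]
  have : ∏ l ∈ Finset.univ.erase i, p l (Function.update x i a l)
      = ∏ l ∈ Finset.univ.erase i, p l (x l) :=
    Finset.prod_congr rfl fun l hl => by
      rw [Function.update_of_ne (Finset.ne_of_mem_erase hl)]
  rw [this]; ring

theorem sum_piFinset_prod_mul (t : ι → Finset α) (p : ι → α → ℝ) (g : ι → α → ℝ) :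
    ∑ x ∈ Fintype.piFinset t, (∏ l, p l (x l)) * ∏ l, g l (x l)
      = ∏ l, ∑ a ∈ t l, p l a * g l a := by
  rw [Finset.prod_univ_sum]
  simp only [Finset.prod_mul_distrib]

/-- Independence of two coordinates conditionally on a rectangle, with the normalization multiplied
out so that nothing is divided by the weight of the rectangle. -/
theorem sum_piFinset_cross (t : ι → Finset α) (p : ι → α → ℝ) (s : α → ℝ) {i j : ι} (hij : i ≠ j) :
    (∑ x ∈ Fintype.piFinset t, (∏ l, p l (x l)) * s (x i)) *
      (∑ x ∈ Fintype.piFinset t, (∏ l, p l (x l)) * s (x j)) =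
    (∑ x ∈ Fintype.piFinset t, ∏ l, p l (x l)) *
      ∑ x ∈ Fintype.piFinset t, (∏ l, p l (x l)) * (s (x i) * s (x j)) := by
  have h1 (i : ι) (x : ι → α) : s (x i) = ∏ l, if l = i then s (x l) else 1 := by simp
  have h2 (x : ι → α) : s (x i) * s (x j)
      = ∏ l, (if l = i then s (x l) else 1) * (if l = j then s (x l) else 1) := by
    rw [Finset.prod_mul_distrib, ← h1, ← h1]
  have h3 : ∑ x ∈ Fintype.piFinset t, ∏ l, p l (x l)
      = ∏ l, ∑ a ∈ t l, p l a * (fun _ _ => 1 : ι → α → ℝ) l a := by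
    rw [← sum_piFinset_prod_mul]; simp
  simp only [h2]
  rw [Finset.sum_congr rfl fun x _ => congrArg (_ * ·) (h1 i x),
    Finset.sum_congr (g := fun x => (∏ l, p l (x l)) * ∏ l, if l = j then s (x l) else 1) rfl
      fun x _ => congrArg (_ * ·) (h1 j x),
    sum_piFinset_prod_mul t p fun l a => if l = i then s a else 1,
    sum_piFinset_prod_mul t p fun l a => if l = j then s a else 1,
    sum_piFinset_prod_mul t p fun l a => (if l = i then s a else 1) * (if l = j then s a else 1),
    h3, ← Finset.prod_mul_distrib, ← Finset.prod_mul_distrib]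
  refine Finset.prod_congr rfl fun l _ => ?_
  by_cases hi : l = i
  · have hj : l ≠ j := fun h => hij (hi.symm.trans h)
    simp [hi, hij, mul_comm]
  · by_cases hj : l = j <;> simp [hi, hj, hij.symm]

variable [Fintype α]

/-- The expectation of `h` under the product of the weights `p i`. -/
def prodExp (p : ι → α → ℝ) (h : (ι → α) → ℝ) : ℝ :=
  ∑ x : ι → α, (∏ i, p i (x i)) * h x

theorem prodExp_resample (p : ι → α → ℝ) (i : ι) (hp : ∑ a, p i a = 1) (h : (ι → α) → ℝ) :
    prodExp p h = prodExp p fun x => ∑ a, p i a * h (Function.update x i a) := by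
  -- Exchanging `x i` with the fresh copy `a` is an involution that preserves the joint weight.
  have e : ∑ q : (ι → α) × α, (∏ l, p l (q.1 l)) * p i q.2 * h (Function.update q.1 i q.2)
      = ∑ q : (ι → α) × α, (∏ l, p l (q.1 l)) * p i q.2 * h q.1 := by
    refine Finset.sum_nbij' (fun q => (Function.update q.1 i q.2, q.1 i))
      (fun q => (Function.update q.1 i q.2, q.1 i)) ?_ ?_ ?_ ?_ ?_
    · simp
    · simp
    · rintro ⟨x, a⟩ -; simp
    · rintro ⟨x, a⟩ -; simp
    · rintro ⟨x, a⟩ -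
      simp only
      rw [prod_update_mul]
  rw [Fintype.sum_prod_type, Fintype.sum_prod_type] at e
  unfold prodExp
  calc ∑ x : ι → α, (∏ l, p l (x l)) * h x
      = ∑ x : ι → α, ∑ a, (∏ l, p l (x l)) * p i a * h x := by
        refine Finset.sum_congr rfl fun x _ => ?_
        rw [← Finset.sum_mul, ← Finset.mul_sum, hp, mul_one]
    _ = _ := e.symm
    _ = _ := by
        refine Finset.sum_congr rfl fun x _ => ?_
        rw [Finset.mul_sum]
        exact Finset.sum_congr rfl fun a _ => by ring

theorem prodExp_add (p : ι → α → ℝ) (g h : (ι → α) → ℝ) :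
    prodExp p (fun x => g x + h x) = prodExp p g + prodExp p h := by
  simp [prodExp, mul_add, Finset.sum_add_distrib]

theorem prodExp_mul_left (p : ι → α → ℝ) (c : ℝ) (h : (ι → α) → ℝ) :
    prodExp p (fun x => c * h x) = c * prodExp p h := by
  simp only [prodExp, Finset.mul_sum]
  exact Finset.sum_congr rfl fun x _ => by ring

theorem prodExp_sum {κ : Type*} (s : Finset κ) (p : ι → α → ℝ) (h : κ → (ι → α) → ℝ) :
    prodExp p (fun x => ∑ j ∈ s, h j x) = ∑ j ∈ s, prodExp p (h j) := by
  simp only [prodExp, Finset.mul_sum]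
  exact Finset.sum_comm

theorem prodExp_one {p : ι → α → ℝ} (hp : ∀ i, ∑ a, p i a = 1) :
    prodExp p (fun _ => 1) = 1 := by
  have := Finset.prod_univ_sum (fun _ : ι => (Finset.univ : Finset α)) p
  simp only [hp, Finset.prod_const_one, Fintype.piFinset_univ] at this
  simp [prodExp, ← this]

theorem prodExp_const {p : ι → α → ℝ} (hp : ∀ i, ∑ a, p i a = 1) (c : ℝ) :
    prodExp p (fun _ => c) = c := by
  have := prodExp_mul_left p c fun _ => 1
  rw [prodExp_one hp] at this
  simpa using this

theorem prodExp_mono {p : ι → α → ℝ} (hp : ∀ i a, 0 ≤ p i a) {g h : (ι → α) → ℝ}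
    (hgh : ∀ x, g x ≤ h x) : prodExp p g ≤ prodExp p h :=
  Finset.sum_le_sum fun x _ =>
    mul_le_mul_of_nonneg_left (hgh x) (Finset.prod_nonneg fun i _ => hp i _)

theorem prodExp_nonneg {p : ι → α → ℝ} (hp : ∀ i a, 0 ≤ p i a) {h : (ι → α) → ℝ}
    (hh : ∀ x, 0 ≤ h x) : 0 ≤ prodExp p h :=
  Finset.sum_nonneg fun x _ => mul_nonneg (Finset.prod_nonneg fun i _ => hp i _) (hh x)

theorem prodExp_coord {p : ι → α → ℝ} (hp : ∀ i, ∑ a, p i a = 1) (i : ι) (φ : α → ℝ) :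
    prodExp p (fun x => φ (x i)) = ∑ a, p i a * φ a := by
  rw [prodExp_resample p i (hp i)]
  simp only [Function.update_self]
  exact prodExp_const hp _

/-- If `g` does not depend on the coordinate `i`, then `g x` and `φ (x i)` are independent. -/
theorem prodExp_mul_coord {p : ι → α → ℝ} (i : ι) (hp : ∑ a, p i a = 1)
    (g : (ι → α) → ℝ) (hg : ∀ x a, g (Function.update x i a) = g x) (φ : α → ℝ) :
    prodExp p (fun x => g x * φ (x i)) = prodExp p g * ∑ a, p i a * φ a := by
  rw [prodExp_resample p i hp]
  simp only [Function.update_self, hg]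
  rw [mul_comm, ← prodExp_mul_left]
  congr 1
  ext x
  rw [Finset.sum_mul]
  exact Finset.sum_congr rfl fun a _ => by ring

theorem prodExp_sq_sum {p : ι → α → ℝ} (hp : ∀ i, ∑ a, p i a = 1) (φ : α → ℝ)
    (hφ : ∀ i, ∑ a, p i a * φ a = 0) (I : Finset ι) :
    prodExp p (fun x => (∑ i ∈ I, φ (x i)) ^ 2) = ∑ i ∈ I, ∑ a, p i a * φ a ^ 2 := by
  simp only [sq, Finset.sum_mul_sum]
  rw [prodExp_sum]
  refine Finset.sum_congr rfl fun i hi => ?_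
  rw [prodExp_sum, Finset.sum_eq_single_of_mem i hi]
  · exact prodExp_coord hp i fun a => φ a * φ a
  · intro j _ hj
    have := prodExp_mul_coord (p := p) j (hp j) (fun x => φ (x i))
      (fun x a => by rw [Function.update_of_ne hj.symm]) φ
    rw [this, hφ, mul_zero]

end ProductWeights

/-! ### Fisher information of a statistic with rectangular fibres -/

section Information

variable {ι α L : Type*} [Fintype ι] [DecidableEq ι] [Fintype α] [DecidableEq L]

/-- The sum of `f` over the fibre of `Y` above `y`. -/
def fiberSum {X : Type*} [Fintype X] (Y : X → L) (f : X → ℝ) (y : L) : ℝ :=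
  ∑ x with Y x = y, f x

theorem sum_fiberSum {X : Type*} [Fintype X] (Y : X → L) (f : X → ℝ) (g : L → ℝ) :
    ∑ y ∈ Finset.univ.image Y, g y * fiberSum Y f y = ∑ x, g (Y x) * f x := by
  rw [← Finset.sum_fiberwise_of_maps_to (t := Finset.univ.image Y) (g := Y)
    (fun x hx => Finset.mem_image_of_mem Y hx)]
  refine Finset.sum_congr rfl fun y _ => ?_
  rw [fiberSum, Finset.mul_sum]
  refine Finset.sum_congr rfl fun x hx => ?_
  rw [(Finset.mem_filter.1 hx).2]

theorem sum_fiberSum_one {X : Type*} [Fintype X] (Y : X → L) (f : X → ℝ) :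
    ∑ y ∈ Finset.univ.image Y, fiberSum Y f y = ∑ x, f x := by
  simpa using sum_fiberSum Y f 1

theorem fiberSum_pos {X : Type*} [Fintype X] {Y : X → L} {f : X → ℝ} (hf : ∀ x, 0 < f x) {y : L}
    (hy : y ∈ Finset.univ.image Y) : 0 < fiberSum Y f y := by
  obtain ⟨x, -, rfl⟩ := Finset.mem_image.1 hy
  exact Finset.sum_pos (fun x _ => hf x) ⟨x, by simp⟩

/-- The Fisher information of the statistic `Y`, when `f` is the law of the observation and `f'`
its derivative. -/
def fisherInfo {X : Type*} [Fintype X] (Y : X → L) (f f' : X → ℝ) : ℝ :=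
  ∑ y ∈ Finset.univ.image Y, fiberSum Y f' y ^ 2 / fiberSum Y f y

/-- Given the value of `Y` the coordinates remain independent, because the fibres are rectangles. So
the product of the conditional means of two scores is the conditional mean of their product, which
averages to zero: the cross terms in the square vanish. -/
theorem fisherInfo_eq_sum (p s : α → ℝ) (hpos : ∀ a, 0 < p a) (hp : ∑ a, p a = 1)
    (hs : ∑ a, p a * s a = 0) (Y : (ι → α) → L) (A : L → ι → Finset α)
    (hA : ∀ x₀ x, Y x = Y x₀ ↔ ∀ i, x i ∈ A (Y x₀) i) :
    fisherInfo Y (fun x => ∏ i, p (x i)) (fun x => (∏ i, p (x i)) * ∑ i, s (x i))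
      = ∑ i, fisherInfo Y (fun x => ∏ i, p (x i)) (fun x => (∏ i, p (x i)) * s (x i)) := by
  have hfib : ∀ y ∈ Finset.univ.image Y,
      (Finset.univ.filter fun x => Y x = y) = Fintype.piFinset (A y) := by
    intro y hy
    obtain ⟨x₀, -, rfl⟩ := Finset.mem_image.1 hy
    ext x
    simp [hA x₀ x]
  have hQ : ∀ x : ι → α, 0 < ∏ i, p (x i) := fun x => Finset.prod_pos fun i _ => hpos _
  have hexp : ∀ y, fiberSum Y (fun x => (∏ i, p (x i)) * ∑ i, s (x i)) y
      = ∑ i, fiberSum Y (fun x => (∏ i, p (x i)) * s (x i)) y := by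
    intro y
    simp only [fiberSum, Finset.mul_sum]
    exact Finset.sum_comm
  have hcross : ∀ i j, i ≠ j → ∑ y ∈ Finset.univ.image Y,
      fiberSum Y (fun x => (∏ i, p (x i)) * s (x i)) y *
          fiberSum Y (fun x => (∏ i, p (x i)) * s (x j)) y
        / fiberSum Y (fun x => ∏ i, p (x i)) y = 0 := by
    intro i j hij
    have h1 : ∀ y ∈ Finset.univ.image Y,
        fiberSum Y (fun x => (∏ i, p (x i)) * s (x i)) y *
          fiberSum Y (fun x => (∏ i, p (x i)) * s (x j)) y
          / fiberSum Y (fun x => ∏ i, p (x i)) y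
            = fiberSum Y (fun x => (∏ i, p (x i)) * (s (x i) * s (x j))) y := by
      intro y hy
      rw [div_eq_iff (fiberSum_pos hQ hy).ne']
      simp only [fiberSum, hfib y hy]
      rw [sum_piFinset_cross (A y) (fun _ => p) s hij, mul_comm]
    rw [Finset.sum_congr rfl h1, sum_fiberSum_one]
    have := prodExp_mul_coord (p := fun _ : ι => p) j hp (fun x => s (x i))
      (fun x a => by rw [Function.update_of_ne hij]) s
    rw [hs, mul_zero] at this
    exact this
  unfold fisherInfo
  simp only [hexp, sq, Finset.sum_mul_sum, Finset.sum_div]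
  rw [Finset.sum_comm]
  refine Finset.sum_congr rfl fun i _ => ?_
  rw [Finset.sum_comm, Finset.sum_eq_single i]
  · intro j _ hj
    exact hcross i j hj.symm
  · simp

/-- Revealing all observations but the `i`th one does not decrease the information about it. -/
theorem fisherInfo_coord_le (p s : α → ℝ) (hpos : ∀ a, 0 < p a) (hp : ∑ a, p a = 1)
    (Y : (ι → α) → L) (i : ι) :
    fisherInfo Y (fun x => ∏ i, p (x i)) (fun x => (∏ i, p (x i)) * s (x i)) ≤
      prodExp (fun _ => p) fun x =>
        fisherInfo (fun a => Y (Function.update x i a)) p (fun a => p a * s a) := by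
  classical
  have hQ : ∀ x : ι → α, 0 < ∏ i, p (x i) := fun x => Finset.prod_pos fun i _ => hpos _
  have hres : ∀ (g : α → ℝ) y, fiberSum Y (fun x => (∏ i, p (x i)) * g (x i)) y
      = ∑ x : ι → α, (∏ i, p (x i)) *
        fiberSum (fun a => Y (Function.update x i a)) (fun a => p a * g a) y := by
    intro g y
    have h := prodExp_resample (fun _ : ι => p) i hp fun x => if Y x = y then g (x i) else 0
    simp only [prodExp, Function.update_self] at h
    simp only [fiberSum, Finset.sum_filter]
    simp only [mul_ite, mul_zero] at h ⊢
    exact h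
  have hres1 : ∀ y, fiberSum Y (fun x => ∏ i, p (x i)) y
      = ∑ x : ι → α, (∏ i, p (x i)) * fiberSum (fun a => Y (Function.update x i a)) p y := by
    intro y
    simpa using hres (fun _ => 1) y
  have hnn : ∀ (x : ι → α) y, 0 ≤ fiberSum (fun a => Y (Function.update x i a)) p y :=
    fun x y => Finset.sum_nonneg fun a _ => (hpos a).le
  -- Joint convexity of `(u, v) ↦ u ^ 2 / v`, in the form of Cauchy–Schwarz: both fibre sums are
  -- averages over `x` of sums along the `i`th coordinate.
  have key : ∀ y ∈ Finset.univ.image Y,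
      fiberSum Y (fun x => (∏ i, p (x i)) * s (x i)) y ^ 2 / fiberSum Y (fun x => ∏ i, p (x i)) y
      ≤ ∑ x : ι → α, (∏ i, p (x i)) *
        (fiberSum (fun a => Y (Function.update x i a)) (fun a => p a * s a) y ^ 2 /
          fiberSum (fun a => Y (Function.update x i a)) p y) := by
    intro y hy
    rw [div_le_iff₀ (fiberSum_pos hQ hy), hres, hres1, mul_comm]
    refine Finset.sum_sq_le_sum_mul_sum_of_sq_le_mul _ ?_ ?_ ?_
    · exact fun x _ => mul_nonneg (hQ x).le (hnn x y)
    · exact fun x _ => mul_nonneg (hQ x).le (div_nonneg (sq_nonneg _) (hnn x y))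
    · intro x _
      rcases Finset.eq_empty_or_nonempty
        (Finset.univ.filter fun a => Y (Function.update x i a) = y) with h | h
      · simp [fiberSum, h]
      · have : 0 < fiberSum (fun a => Y (Function.update x i a)) p y :=
          Finset.sum_pos (fun a _ => hpos a) h
        apply le_of_eq
        field_simp
  unfold fisherInfo prodExp
  refine (Finset.sum_le_sum key).trans (le_of_eq ?_)
  rw [Finset.sum_comm]
  refine Finset.sum_congr rfl fun x _ => ?_
  rw [← Finset.mul_sum]
  congr 1
  symm
  -- A value that this section of `Y` does not attain has an empty fibre and contributes `0 ^ 2 / 0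
  -- = 0`.
  apply Finset.sum_subset
  · intro y hy
    obtain ⟨a, -, rfl⟩ := Finset.mem_image.1 hy
    exact Finset.mem_image_of_mem Y (Finset.mem_univ _)
  · intro y _ hy
    have : (Finset.univ.filter fun a => Y (Function.update x i a) = y) = ∅ := by
      refine Finset.filter_eq_empty_iff.2 fun a ha h => hy ?_
      exact Finset.mem_image.2 ⟨a, Finset.mem_univ _, h⟩
    simp [fiberSum, this]

/-- Reduction to one sensor: the trace of the information splits over the sensors, and with the
other samples revealed each share is that of a statistic of one sample with at most `K` values. -/
theorem sum_fisherInfo_le {J : Type*} [Fintype J] (p : α → ℝ) (s : J → α → ℝ)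
    (hpos : ∀ a, 0 < p a) (hp : ∑ a, p a = 1) (hs : ∀ j, ∑ a, p a * s j a = 0)
    (Y : (ι → α) → L) (A : L → ι → Finset α)
    (hA : ∀ x₀ x, Y x = Y x₀ ↔ ∀ i, x i ∈ A (Y x₀) i) (K : ℕ)
    (hK : ∀ x i, (Finset.univ.image fun a => Y (Function.update x i a)).card ≤ K) (b : ℝ)
    (hb : ∀ f : α → L, (Finset.univ.image f).card ≤ K →
      ∑ j, fisherInfo f p (fun a => p a * s j a) ≤ b) :
    ∑ j, fisherInfo Y (fun x => ∏ i, p (x i)) (fun x => (∏ i, p (x i)) * ∑ i, s j (x i))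
      ≤ Fintype.card ι * b := by
  calc _ = ∑ j, ∑ i, fisherInfo Y (fun x => ∏ i, p (x i))
        (fun x => (∏ i, p (x i)) * s j (x i)) :=
        Finset.sum_congr rfl fun j _ => fisherInfo_eq_sum p (s j) hpos hp (hs j) Y A hA
    _ = ∑ i, ∑ j, fisherInfo Y (fun x => ∏ i, p (x i))
        (fun x => (∏ i, p (x i)) * s j (x i)) := Finset.sum_comm
    _ ≤ ∑ _i : ι, b := by
        refine Finset.sum_le_sum fun i _ => ?_
        refine (Finset.sum_le_sum fun j _ => fisherInfo_coord_le p (s j) hpos hp Y i).trans ?_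
        rw [← prodExp_sum]
        refine (prodExp_mono (fun _ a => (hpos a).le) fun x => hb _ (hK x i)).trans ?_
        rw [prodExp_const fun _ => hp]
    _ = _ := by simp

end Information

/-! ### A van Trees inequality for finite experiments -/

section VanTrees

variable {m : ℕ}

/-- The uniform distribution on the cube `[0, 1]^m`. -/
def cubeMeasure (m : ℕ) : Measure (Fin m → ℝ) :=
  Measure.pi fun _ => volume.restrict (Set.Icc 0 1)

instance : IsProbabilityMeasure (volume.restrict (Set.Icc (0 : ℝ) 1)) :=
  ⟨by simp⟩

instance : IsProbabilityMeasure (cubeMeasure m) := by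
  unfold cubeMeasure; infer_instance

theorem ae_mem_cube : ∀ᵐ u ∂cubeMeasure m, ∀ i, u i ∈ Set.Icc (0 : ℝ) 1 := by
  rw [ae_all_iff]
  intro i
  exact (Measure.quasiMeasurePreserving_eval _ i).ae
    (ae_restrict_mem measurableSet_Icc)

/-- Resampling one coordinate preserves the uniform law. This lets the integration by parts act on
one coordinate with the others held fixed. -/
theorem measurePreserving_update (j : Fin m) :
    MeasurePreserving (fun q : (Fin m → ℝ) × ℝ => Function.update q.1 j q.2)
      ((cubeMeasure m).prod (volume.restrict (Set.Icc 0 1))) (cubeMeasure m) := by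
  have hmeas : Measurable fun q : (Fin m → ℝ) × ℝ => Function.update q.1 j q.2 := by
    rw [measurable_pi_iff]
    intro i
    by_cases h : i = j
    · subst h; simpa using measurable_snd
    · simp only [Function.update_of_ne h]
      fun_prop
  refine ⟨hmeas, ?_⟩
  symm
  refine Measure.pi_eq fun s hs => ?_
  rw [Measure.map_apply hmeas (MeasurableSet.univ_pi hs)]
  have : (fun q : (Fin m → ℝ) × ℝ => Function.update q.1 j q.2) ⁻¹' Set.univ.pi s
      = (Set.univ.pi (Function.update s j Set.univ)) ×ˢ s j := by
    ext q
    simp only [Set.mem_preimage, Set.mem_pi, Set.mem_univ, true_implies, Set.mem_prod]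
    constructor
    · intro h
      refine ⟨fun i => ?_, by simpa using h j⟩
      by_cases hi : i = j
      · subst hi; simp
      · simpa [Function.update_of_ne hi] using h i
    · rintro ⟨h1, h2⟩ i
      by_cases hi : i = j
      · subst hi; simpa using h2
      · simpa [Function.update_of_ne hi] using h1 i
  rw [this, Measure.prod_prod, cubeMeasure, Measure.pi_pi,
    ← Finset.mul_prod_erase _ _ (Finset.mem_univ j), Function.update_self, measure_univ, one_mul,
    ← Finset.mul_prod_erase (a := j) Finset.univ _ (Finset.mem_univ j), mul_comm]
  congr 1
  refine Finset.prod_congr rfl fun i hi => ?_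
  rw [Function.update_of_ne (Finset.ne_of_mem_erase hi)]

theorem integrable_cubeMeasure {f : (Fin m → ℝ) → ℝ} (hf : Continuous f) :
    Integrable f (cubeMeasure m) := by
  have hK : IsCompact (Set.univ.pi fun _ : Fin m => Set.Icc (0 : ℝ) 1) :=
    isCompact_univ_pi fun _ => isCompact_Icc
  obtain ⟨C, hC⟩ := hK.exists_bound_of_continuousOn hf.continuousOn
  refine Integrable.of_bound hf.aestronglyMeasurable C ?_
  filter_upwards [ae_mem_cube] with u hu
  exact hC u fun i _ => hu i

theorem integral_cubeMeasure_update (j : Fin m) {f : (Fin m → ℝ) → ℝ} (hf : Continuous f) :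
    ∫ u, f u ∂cubeMeasure m
      = ∫ u, (∫ t in (0 : ℝ)..1, f (Function.update u j t)) ∂cubeMeasure m := by
  have hp := measurePreserving_update j
  have hint := integrable_cubeMeasure hf
  rw [← hp.map_eq] at hint
  conv_lhs => rw [← hp.map_eq]
  rw [integral_map hp.measurable.aemeasurable hf.aestronglyMeasurable, integral_prod]
  · refine integral_congr_ae (Filter.Eventually.of_forall fun u => ?_)
    simp only
    rw [intervalIntegral.integral_of_le zero_le_one, integral_Icc_eq_integral_Ioc]
  · exact (integrable_map_measure hf.aestronglyMeasurable hp.measurable.aemeasurable).1 hint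

/-- Integration by parts against the weight `t * (1 - t)`, which vanishes at both ends. -/
theorem integral_weighted_deriv (A A' : ℝ → ℝ) (hA : ∀ t, HasDerivAt A (A' t) t)
    (hA' : Continuous A') :
    ∫ t in (0 : ℝ)..1, ((1 - 2 * t) * (A t - t) + t * (1 - t) * A' t) = 1 / 6 := by
  have hAc : Continuous A := continuous_iff_continuousAt.2 fun t => (hA t).continuousAt
  -- The integrand is the derivative of `t * (1 - t) * (A t - t)` plus `t * (1 - t)`; the polynomial
  -- summand is a primitive of the latter and accounts for the value `1 / 6`.
  have hd : ∀ t ∈ Set.uIcc (0 : ℝ) 1, HasDerivAt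
      (fun t => t * (1 - t) * (A t - t) + (t ^ 2 / 2 - t ^ 3 / 3))
      ((1 - 2 * t) * (A t - t) + t * (1 - t) * A' t) t := by
    intro t _
    have h1 : HasDerivAt (fun t : ℝ => t * (1 - t)) (1 * (1 - t) + t * (0 - 1)) t :=
      (hasDerivAt_id' t).fun_mul ((hasDerivAt_const t 1).fun_sub (hasDerivAt_id' t))
    have h2 := h1.fun_mul ((hA t).fun_sub (hasDerivAt_id' t))
    have h3 : HasDerivAt (fun t : ℝ => t ^ 2 / 2 - t ^ 3 / 3)
        ((2 * t ^ 1) / 2 - (3 * t ^ 2) / 3) t := by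
      have := ((hasDerivAt_pow 2 t).div_const 2).fun_sub ((hasDerivAt_pow 3 t).div_const 3)
      simpa using this
    exact (h2.fun_add h3).congr_deriv (by ring)
  rw [intervalIntegral.integral_eq_sub_of_hasDerivAt hd]
  · norm_num
  · exact Continuous.intervalIntegrable (by fun_prop) _ _

variable {X L : Type*} [Fintype X] [DecidableEq L]

/-- On each fibre of `Y`, expand the square of `(T - t) - a * ψ`, where `ψ = (1 - 2 * t) + t * (1 -
t) * q' / q` is the score of the density weighted by `t * (1 - t)`. The second moment of `ψ` is at
most `1 + fisherInfo Y Q Q'`, its cross term being zero because `Q'` sums to zero. -/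
theorem sum_sq_error_ge (Q Q' : X → ℝ) (hpos : ∀ x, 0 < Q x) (hQ : ∑ x, Q x = 1)
    (hQ' : ∑ x, Q' x = 0) (Y : X → L) (T : L → ℝ) {t : ℝ} (ht : t ∈ Set.Icc (0 : ℝ) 1) (a : ℝ) :
    2 * a * ((1 - 2 * t) * (∑ x, Q x * T (Y x) - t) + t * (1 - t) * ∑ x, Q' x * T (Y x))
      - a ^ 2 * (1 + fisherInfo Y Q Q') ≤ ∑ x, Q x * (T (Y x) - t) ^ 2 := by
  obtain ⟨ht0, ht1⟩ := ht
  have hI : 0 ≤ fisherInfo Y Q Q' := Finset.sum_nonneg fun y hy =>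
    div_nonneg (sq_nonneg _) (fiberSum_pos hpos hy).le
  have hc : (t * (1 - t)) ^ 2 ≤ 1 := by
    have h0 : 0 ≤ t * (1 - t) := mul_nonneg ht0 (by linarith)
    have h1 : t * (1 - t) ≤ 1 := by nlinarith
    nlinarith
  have hc' : (1 - 2 * t) ^ 2 ≤ 1 := by nlinarith
  have key : ∀ y ∈ Finset.univ.image Y,
      2 * a * ((1 - 2 * t) * ((T y - t) * fiberSum Y Q y)
          + t * (1 - t) * ((T y - t) * fiberSum Y Q' y))
        - a ^ 2 * ((1 - 2 * t) ^ 2 * fiberSum Y Q y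
            + 2 * (1 - 2 * t) * (t * (1 - t)) * fiberSum Y Q' y
            + (t * (1 - t)) ^ 2 * (fiberSum Y Q' y ^ 2 / fiberSum Y Q y))
      ≤ (T y - t) ^ 2 * fiberSum Y Q y := by
    intro y hy
    have hq := fiberSum_pos hpos hy
    set q := fiberSum Y Q y
    set q' := fiberSum Y Q' y
    have h := mul_nonneg hq.le
      (sq_nonneg ((T y - t) - a * ((1 - 2 * t) + t * (1 - t) * (q' / q))))
    have e : q * ((T y - t) - a * ((1 - 2 * t) + t * (1 - t) * (q' / q))) ^ 2
        = (T y - t) ^ 2 * q - (2 * a * ((1 - 2 * t) * ((T y - t) * q)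
          + t * (1 - t) * ((T y - t) * q'))
        - a ^ 2 * ((1 - 2 * t) ^ 2 * q + 2 * (1 - 2 * t) * (t * (1 - t)) * q'
            + (t * (1 - t)) ^ 2 * (q' ^ 2 / q))) := by
      field_simp
      ring
    linarith
  have hs := Finset.sum_le_sum key
  rw [sum_fiberSum Y Q fun y => (T y - t) ^ 2] at hs
  simp only [Finset.sum_sub_distrib, ← Finset.mul_sum, Finset.sum_add_distrib] at hs
  rw [sum_fiberSum Y Q fun y => T y - t, sum_fiberSum Y Q' fun y => T y - t,
    sum_fiberSum_one, sum_fiberSum_one, hQ, hQ'] at hs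
  have e1 : ∑ x, (T (Y x) - t) * Q x = ∑ x, Q x * T (Y x) - t := by
    simp only [sub_mul, Finset.sum_sub_distrib, ← Finset.mul_sum, hQ, mul_one]
    simp only [mul_comm]
  have e2 : ∑ x, (T (Y x) - t) * Q' x = ∑ x, Q' x * T (Y x) := by
    simp only [sub_mul, Finset.sum_sub_distrib, ← Finset.mul_sum, hQ', mul_zero, sub_zero]
    simp only [mul_comm]
  rw [e1, e2] at hs
  have e3 : ∑ x, (T (Y x) - t) ^ 2 * Q x = ∑ x, Q x * (T (Y x) - t) ^ 2 := by
    simp only [mul_comm]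
  rw [e3] at hs
  refine le_trans ?_ hs
  change _ ≤ _ - a ^ 2 * (_ + (t * (1 - t)) ^ 2 * fisherInfo Y Q Q')
  have : a ^ 2 * ((1 - 2 * t) ^ 2 * 1 + 2 * (1 - 2 * t) * (t * (1 - t)) * 0
      + (t * (1 - t)) ^ 2 * fisherInfo Y Q Q') ≤ a ^ 2 * (1 + fisherInfo Y Q Q') := by
    refine mul_le_mul_of_nonneg_left ?_ (sq_nonneg a)
    nlinarith [mul_le_mul_of_nonneg_right hc hI]
  linarith

/-- The uniform prior does not vanish on the boundary of the cube; the factor `t * (1 - t)` in the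
test function removes the boundary terms instead. One multiplier `a` for all coordinates makes only
the trace of the information matter. -/
theorem vanTrees (Q : (Fin m → ℝ) → X → ℝ) (Q' : Fin m → (Fin m → ℝ) → X → ℝ)
    (hQc : ∀ x, Continuous fun u => Q u x) (hQc' : ∀ j x, Continuous fun u => Q' j u x)
    (hderiv : ∀ u j x, HasDerivAt (fun t => Q (Function.update u j t) x) (Q' j u x) (u j))
    (hsum : ∀ u, ∑ x, Q u x = 1)
    (hpos : ∀ u, (∀ i, u i ∈ Set.Icc (0 : ℝ) 1) → ∀ x, 0 < Q u x)
    (Y : X → L) (T : L → Fin m → ℝ) (B : ℝ)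
    (hB : 0 ≤ B) (hinfo : ∀ u, (∀ i, u i ∈ Set.Icc (0 : ℝ) 1) →
      ∑ j, fisherInfo Y (Q u) (Q' j u) ≤ B) :
    (m : ℝ) ^ 2 / (36 * (m + B)) ≤
      ∫ u, ∑ x, Q u x * ∑ j, (T (Y x) j - u j) ^ 2 ∂cubeMeasure m := by
  have hsum' : ∀ j u, ∑ x, Q' j u x = 0 := by
    intro j u
    have h1 : HasDerivAt (fun t => ∑ x, Q (Function.update u j t) x) (∑ x, Q' j u x) (u j) :=
      HasDerivAt.fun_sum fun x _ => hderiv u j x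
    simp only [hsum] at h1
    exact h1.unique (hasDerivAt_const _ _)
  set H : Fin m → (Fin m → ℝ) → ℝ := fun j u =>
    (1 - 2 * u j) * (∑ x, Q u x * T (Y x) j - u j) + u j * (1 - u j) * ∑ x, Q' j u x * T (Y x) j
    with hH
  have hHc : ∀ j, Continuous (H j) := by
    intro j
    simp only [hH]
    fun_prop
  have hHint : ∀ j, ∫ u, H j u ∂cubeMeasure m = 1 / 6 := by
    intro j
    rw [integral_cubeMeasure_update j (hHc j)]
    have : ∀ u : Fin m → ℝ, ∫ t in (0 : ℝ)..1, H j (Function.update u j t) = 1 / 6 := by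
      intro u
      simp only [hH, Function.update_self]
      refine integral_weighted_deriv (fun t => ∑ x, Q (Function.update u j t) x * T (Y x) j)
        (fun t => ∑ x, Q' j (Function.update u j t) x * T (Y x) j) ?_ ?_
      · intro t
        refine HasDerivAt.fun_sum fun x _ => ?_
        have := (hderiv (Function.update u j t) j x).mul_const (T (Y x) j)
        simpa using this
      · have hup : Continuous fun t : ℝ => Function.update u j t :=
          continuous_const.update j continuous_id
        exact continuous_finsetSum _ fun x _ => ((hQc' j x).comp hup).mul continuous_const
    simp [this]
  have hFc : Continuous fun u => ∑ x, Q u x * ∑ j, (T (Y x) j - u j) ^ 2 := by fun_prop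
  rcases Nat.eq_zero_or_pos m with hm0 | hm
  · subst hm0
    simp
  have hm' : (0 : ℝ) < m := by exact_mod_cast hm
  -- The maximizer of `2 * a * (m / 6) - a ^ 2 * (m + B)`.
  set a : ℝ := m / (6 * (m + B)) with ha
  have hle : ∫ u, (2 * a * ∑ j, H j u - a ^ 2 * (m + B)) ∂cubeMeasure m ≤
      ∫ u, ∑ x, Q u x * ∑ j, (T (Y x) j - u j) ^ 2 ∂cubeMeasure m := by
    refine integral_mono_ae (integrable_cubeMeasure (by fun_prop)) (integrable_cubeMeasure hFc) ?_
    filter_upwards [ae_mem_cube] with u hu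
    have h := Finset.sum_le_sum fun j (_ : j ∈ Finset.univ) =>
      sum_sq_error_ge (Q u) (Q' j u) (hpos u hu) (hsum u) (hsum' j u) Y (fun y => T y j) (hu j) a
    simp only [Finset.mul_sum]
    rw [Finset.sum_comm]
    refine le_trans ?_ h
    simp only [Finset.sum_sub_distrib, ← Finset.mul_sum, Finset.sum_add_distrib, Finset.sum_const,
      Finset.card_univ, Fintype.card_fin, nsmul_eq_mul, mul_one, hH]
    have := mul_le_mul_of_nonneg_left (hinfo u hu) (sq_nonneg a)
    linarith
  refine le_trans (le_of_eq ?_) hle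
  rw [integral_sub (integrable_cubeMeasure (by fun_prop)) (integrable_const _),
    integral_const_mul, integral_finsetSum _ fun j _ => integrable_cubeMeasure (hHc j)]
  simp only [hHint, integral_const, probReal_univ, Finset.sum_const, Finset.card_univ,
    Fintype.card_fin, nsmul_eq_mul, smul_eq_mul, one_mul]
  have : (m : ℝ) + B ≠ 0 := by positivity
  rw [ha]
  field_simp
  ring

end VanTrees

/-! ### Combinatorics of blackboard protocols -/

namespace BlackboardProtocol

variable {n k : ℕ} {X : Type}

theorem board_length (P : BlackboardProtocol n k X) (x : Fin n → X) (t : ℕ) :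
    (P.board x t).length = t := by
  induction t with
  | zero => rfl
  | succ t ih => simp [board, ih]

theorem board_take (P : BlackboardProtocol n k X) (x : Fin n → X) {s t : ℕ} (h : s ≤ t) :
    (P.board x t).take s = P.board x s := by
  induction t, h using Nat.le_induction with
  | base => exact List.take_of_length_le (P.board_length x s).le
  | succ t h ih =>
    rw [board, List.take_append_of_le_length (by rw [board_length]; exact h), ih]

theorem board_getD (P : BlackboardProtocol n k X) (x : Fin n → X) {s t : ℕ} (h : s < t) :
    (P.board x t).getD s false = P.bit (P.board x s) (x (P.speaker (P.board x s))) := by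
  have h1 : (P.board x t).getD s false = ((P.board x t).take (s + 1)).getD s false := by
    simp [List.getD_eq_getElem?_getD]
  rw [h1, P.board_take x h, board]
  simp [List.getD_eq_getElem?_getD, board_length]

/-- The samples of sensor `i` that are consistent with the first `t` bits of the transcript `y`. -/
def Consistent (P : BlackboardProtocol n k X) (t : ℕ) (y : List Bool) (i : Fin n) (a : X) : Prop :=
  ∀ s < t, P.speaker (y.take s) = i → P.bit (y.take s) a = y.getD s false

/-- The rectangle property: each bit of a transcript constrains only the sample of the sensor that
wrote it. -/
theorem board_eq_iff (P : BlackboardProtocol n k X) (x₀ x : Fin n → X) (t : ℕ) :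
    P.board x t = P.board x₀ t ↔ ∀ i, P.Consistent t (P.board x₀ t) i (x i) := by
  constructor
  · rintro h i s hs rfl
    rw [← h, P.board_take x hs.le, P.board_getD x hs]
  · intro h
    have : ∀ s ≤ t, P.board x s = P.board x₀ s := by
      intro s
      induction s with
      | zero => intro _; rfl
      | succ s ih =>
        intro hs
        have hb := h (P.speaker (P.board x₀ s)) s hs
          (by rw [P.board_take x₀ (Nat.le_of_succ_le hs)])
        rw [P.board_take x₀ (Nat.le_of_succ_le hs), P.board_getD x₀ hs] at hb
        rw [board, board, ih (Nat.le_of_succ_le hs), hb]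
    exact this t le_rfl

/-- The number of bits that sensor `i` has written, when the board shows `h`. -/
def turns (P : BlackboardProtocol n k X) (i : Fin n) (h : List Bool) : ℕ :=
  ((Finset.range h.length).filter fun s => P.speaker (h.take s) = i).card

theorem turns_append (P : BlackboardProtocol n k X) (i : Fin n) (h : List Bool) (b : Bool) :
    P.turns i (h ++ [b]) = P.turns i h + if P.speaker h = i then 1 else 0 := by
  unfold turns
  rw [List.length_append, List.length_singleton, Finset.range_add_one, Finset.filter_insert]
  have : (Finset.range h.length).filter (fun s => P.speaker ((h ++ [b]).take s) = i)
      = (Finset.range h.length).filter (fun s => P.speaker (h.take s) = i) := by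
    refine Finset.filter_congr fun s hs => ?_
    rw [List.take_append_of_le_length (Finset.mem_range.1 hs).le]
  rw [List.take_left, this]
  split_ifs
  · rw [Finset.card_insert_of_notMem (by simp)]
  · rfl

variable [Fintype X]

/-- Kraft's inequality for the boards that sensor `i` can produce when the other samples are
fixed. -/
theorem kraft_board (P : BlackboardProtocol n k X) (x : Fin n → X) (i : Fin n) (t : ℕ) :
    ∑ h ∈ Finset.univ.image fun a => P.board (Function.update x i a) t,
      ((1 : ℝ) / 2) ^ P.turns i h ≤ 1 := by
  induction t with
  | zero =>
    calc _ ≤ ∑ h ∈ ({[]} : Finset (List Bool)), ((1 : ℝ) / 2) ^ P.turns i h := by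
          refine Finset.sum_le_sum_of_subset_of_nonneg ?_ fun _ _ _ => by positivity
          intro h hh
          simp only [board, Finset.mem_image] at hh
          obtain ⟨a, -, rfl⟩ := hh
          simp
      _ = 1 := by simp [turns]
  | succ t ih =>
    refine le_trans ?_ ih
    set R := Finset.univ.image fun a => P.board (Function.update x i a) t
    -- With the other samples fixed, a board branches only when sensor `i` speaks, into two boards
    -- of half the weight each; otherwise its single continuation keeps its weight.
    set next : List Bool → Finset (List Bool) := fun h =>
      if P.speaker h = i then {h ++ [true], h ++ [false]}
      else {h ++ [P.bit h (x (P.speaker h))]}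
    have hnext : ∀ h h', h' ∈ next h → h'.dropLast = h := by
      intro h h' hh
      simp only [next] at hh
      split_ifs at hh <;> aesop
    have hdisj : (R : Set (List Bool)).PairwiseDisjoint next := fun h _ h' _ hne =>
      Finset.disjoint_left.2 fun y hy hy' => hne ((hnext h y hy).symm.trans (hnext h' y hy'))
    calc _ ≤ ∑ h ∈ R.biUnion next, ((1 : ℝ) / 2) ^ P.turns i h := by
          refine Finset.sum_le_sum_of_subset_of_nonneg ?_ fun _ _ _ => by positivity
          intro h hh
          obtain ⟨a, -, rfl⟩ := Finset.mem_image.1 hh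
          refine Finset.mem_biUnion.2
            ⟨P.board (Function.update x i a) t, Finset.mem_image_of_mem _ (Finset.mem_univ a), ?_⟩
          simp only [next, board]
          split_ifs with hs
          · cases P.bit (P.board (Function.update x i a) t)
              (Function.update x i a (P.speaker (P.board (Function.update x i a) t))) <;> simp
          · rw [Function.update_of_ne hs]; simp
      _ ≤ ∑ h ∈ R, ∑ h' ∈ next h, ((1 : ℝ) / 2) ^ P.turns i h' :=
          (Finset.sum_biUnion hdisj).le
      _ ≤ ∑ h ∈ R, ((1 : ℝ) / 2) ^ P.turns i h := by
          refine Finset.sum_le_sum fun h _ => ?_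
          simp only [next]
          split_ifs with hs
          · rw [Finset.sum_pair (by simp)]
            simp only [turns_append, hs, if_true]
            rw [pow_succ]; linarith
          · simp [turns_append, hs]

/-- On a complete transcript sensor `i` has had exactly `k` turns, so all weights in Kraft's
inequality equal `2 ^ (-k)`. -/
theorem card_transcripts_le (P : BlackboardProtocol n k X) (x : Fin n → X) (i : Fin n) :
    (Finset.univ.image fun a => P.transcript (Function.update x i a)).card ≤ 2 ^ k := by
  have h := P.kraft_board x i (n * k)
  have h2 : ∀ y ∈ Finset.univ.image fun a => P.board (Function.update x i a) (n * k),
      ((1 : ℝ) / 2) ^ P.turns i y = (1 / 2) ^ k := by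
    intro y hy
    obtain ⟨a, -, rfl⟩ := Finset.mem_image.1 hy
    have hl := P.board_length (Function.update x i a) (n * k)
    have hb := P.budget _ hl i
    rw [turns, hl, hb]
  rw [Finset.sum_congr rfl h2, Finset.sum_const, nsmul_eq_mul] at h
  have : ((Finset.univ.image fun a => P.transcript (Function.update x i a)).card : ℝ) ≤ 2 ^ k := by
    have h3 : (0 : ℝ) < 2 ^ k := by positivity
    rw [one_div, inv_pow, ← div_eq_mul_inv, div_le_one h3] at h
    exact h
  exact_mod_cast this

end BlackboardProtocol

/-! ### Information in a partition of the sample space -/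

section Partition

variable {α L J : Type*} [Fintype α] [DecidableEq L] [Fintype J]

theorem fiberSum_mul_sq_le (p s : α → ℝ) (hpos : ∀ a, 0 < p a) (f : α → L) (y : L) :
    fiberSum f (fun a => p a * s a) y ^ 2
      ≤ fiberSum f p y * fiberSum f (fun a => p a * s a ^ 2) y := by
  refine Finset.sum_sq_le_sum_mul_sum_of_sq_le_mul _ (fun a _ => (hpos a).le)
    (fun a _ => mul_nonneg (hpos a).le (sq_nonneg _)) fun a _ => ?_
  apply le_of_eq
  ring

/-- The information in a statistic is at most the information in the observation. -/
theorem fisherInfo_le_variance (p s : α → ℝ) (hpos : ∀ a, 0 < p a) (f : α → L) :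
    fisherInfo f p (fun a => p a * s a) ≤ ∑ a, p a * s a ^ 2 := by
  rw [← sum_fiberSum_one f]
  refine Finset.sum_le_sum fun y hy => ?_
  rw [div_le_iff₀ (fiberSum_pos hpos hy), mul_comm]
  exact fiberSum_mul_sq_le p s hpos f y

/-- Bessel's inequality: orthogonal scores carry at most `V` units of information per value of the
statistic. -/
theorem sum_fisherInfo_le_card (p : α → ℝ) (s : J → α → ℝ) (hpos : ∀ a, 0 < p a) {V : ℝ} (hV0 : 0 ≤ V)
    (horth : ∀ i j, i ≠ j → ∑ a, p a * (s i a * s j a) = 0) (hV : ∀ i, ∑ a, p a * s i a ^ 2 ≤ V)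
    (f : α → L) :
    ∑ j, fisherInfo f p (fun a => p a * s j a) ≤ (Finset.univ.image f).card * V := by
  unfold fisherInfo
  rw [Finset.sum_comm]
  rw [← nsmul_eq_mul]
  refine Finset.sum_le_card_nsmul _ _ _ fun y hy => ?_
  have hP := fiberSum_pos hpos hy
  rw [← Finset.sum_div, div_le_iff₀ hP]
  -- Test the cell against `∑ j, c j * s j`. Its partial mean on the cell is `S`, and by
  -- orthogonality its second moment is at most `V * S`; Cauchy–Schwarz then bounds `S` by `V` times
  -- the probability of the cell.
  set c : J → ℝ := fun j => fiberSum f (fun a => p a * s j a) y with hc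
  set S := ∑ j, c j ^ 2 with hS
  have hS0 : 0 ≤ S := Finset.sum_nonneg fun j _ => sq_nonneg _
  have h1 : fiberSum f (fun a => p a * ∑ j, c j * s j a) y = S := by
    simp only [fiberSum, Finset.mul_sum, hS]
    rw [Finset.sum_comm]
    refine Finset.sum_congr rfl fun j _ => ?_
    rw [sq]
    nth_rw 3 [hc]
    simp only [fiberSum, Finset.mul_sum]
    exact Finset.sum_congr rfl fun a _ => by ring
  have h2 : ∑ a, p a * (∑ j, c j * s j a) ^ 2 ≤ V * S := by
    have : ∀ a, p a * (∑ j, c j * s j a) ^ 2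
        = ∑ i, ∑ j, c i * c j * (p a * (s i a * s j a)) := by
      intro a
      rw [sq, Finset.sum_mul_sum, Finset.mul_sum]
      refine Finset.sum_congr rfl fun i _ => ?_
      rw [Finset.mul_sum]
      exact Finset.sum_congr rfl fun j _ => by ring
    simp only [this]
    rw [Finset.sum_comm, hS, Finset.mul_sum]
    refine Finset.sum_le_sum fun i _ => ?_
    rw [Finset.sum_comm, Finset.sum_eq_single i]
    · rw [← Finset.mul_sum, ← sq, mul_comm]
      refine mul_le_mul_of_nonneg_right ?_ (sq_nonneg _)
      simpa only [sq] using hV i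
    · intro j _ hj
      rw [← Finset.mul_sum, horth i j hj.symm, mul_zero]
    · simp
  have h3 := fiberSum_mul_sq_le p (fun a => ∑ j, c j * s j a) hpos f y
  have h4 : fiberSum f (fun a => p a * (∑ j, c j * s j a) ^ 2) y
      ≤ ∑ a, p a * (∑ j, c j * s j a) ^ 2 :=
    Finset.sum_le_sum_of_subset_of_nonneg (Finset.filter_subset _ _)
      fun a _ _ => mul_nonneg (hpos a).le (sq_nonneg _)
  rw [h1] at h3
  rcases hS0.eq_or_lt with h0 | h0
  · rw [← h0]
    exact mul_nonneg hV0 hP.le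
  · have h5 : S ^ 2 ≤ fiberSum f p y * (V * S) :=
      h3.trans (mul_le_mul_of_nonneg_left (h4.trans h2) hP.le)
    nlinarith

/-- Sub-Gaussian scores: the information in a statistic with at most `K` values is at most
logarithmic in `K`. -/
theorem sum_fisherInfo_le_log (p : α → ℝ) (s : J → α → ℝ) (hpos : ∀ a, 0 < p a)
    (hp : ∑ a, p a = 1) {v : ℝ} (hv : 0 < v)
    (hsub : ∀ c : J → ℝ, ∑ a, p a * Real.exp (∑ j, c j * s j a)
      ≤ Real.exp (v * (∑ j, c j ^ 2) / 2)) (f : α → L) {K : ℝ} (hK0 : 0 < K)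
    (hK : ((Finset.univ.image f).card : ℝ) ≤ K) :
    ∑ j, fisherInfo f p (fun a => p a * s j a) ≤ 2 * v * Real.log K := by
  unfold fisherInfo
  rw [Finset.sum_comm]
  have key : ∀ y ∈ Finset.univ.image f,
      ∑ j, fiberSum f (fun a => p a * s j a) y ^ 2 / fiberSum f p y
        ≤ 2 * v * (fiberSum f p y * Real.log K + (1 / K - fiberSum f p y)) := by
    intro y hy
    have hP := fiberSum_pos hpos hy
    set P := fiberSum f p y with hPdef
    -- `μ` is the conditional mean of the score vector on the cell. The exponential moment in the
    -- direction `μ / v`, which is the optimal one, yields `S ≤ 2 * v * log (1 / P)`; averaged over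
    -- the cells, this is `2 * v` times the entropy of the statistic.
    set μ : J → ℝ := fun j => fiberSum f (fun a => p a * s j a) y / P with hμ
    set S := ∑ j, μ j ^ 2 with hS
    have hmean : fiberSum f (fun a => p a * ∑ j, μ j / v * s j a) y = P * (S / v) := by
      simp only [fiberSum, Finset.mul_sum, hS, Finset.sum_div]
      rw [Finset.sum_comm]
      refine Finset.sum_congr rfl fun j _ => ?_
      have : fiberSum f (fun a => p a * s j a) y = P * μ j := by
        simp only [hμ]; field_simp
      calc _ = μ j / v * fiberSum f (fun a => p a * s j a) y := by
            rw [fiberSum, Finset.mul_sum]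
            exact Finset.sum_congr rfl fun a _ => by ring
        _ = _ := by rw [this]; ring
    -- Jensen's inequality on the cell, through the tangent line of `exp` at `S / v`.
    have hjensen : P * Real.exp (S / v)
        ≤ fiberSum f (fun a => p a * Real.exp (∑ j, μ j / v * s j a)) y := by
      have h1 : ∀ a, p a * (Real.exp (S / v) * (1 + (∑ j, μ j / v * s j a - S / v)))
          ≤ p a * Real.exp (∑ j, μ j / v * s j a) := by
        intro a
        refine mul_le_mul_of_nonneg_left ?_ (hpos a).le
        have h2 := Real.add_one_le_exp (∑ j, μ j / v * s j a - S / v)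
        calc _ ≤ Real.exp (S / v) * Real.exp (∑ j, μ j / v * s j a - S / v) :=
              mul_le_mul_of_nonneg_left (by linarith) (Real.exp_pos _).le
          _ = _ := by rw [← Real.exp_add]; congr 1; ring
      refine le_trans (le_of_eq ?_) (Finset.sum_le_sum fun a _ => h1 a)
      have h3 : ∀ a, p a * (Real.exp (S / v) * (1 + (∑ j, μ j / v * s j a - S / v)))
          = Real.exp (S / v) * (1 - S / v) * p a
            + Real.exp (S / v) * (p a * ∑ j, μ j / v * s j a) := fun a => by ring
      simp only [h3]
      rw [Finset.sum_add_distrib, ← Finset.mul_sum, ← Finset.mul_sum]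
      change _ = _ * fiberSum f p y + _ * fiberSum f (fun a => p a * ∑ j, μ j / v * s j a) y
      rw [hmean]
      ring
    have htot : fiberSum f (fun a => p a * Real.exp (∑ j, μ j / v * s j a)) y
        ≤ Real.exp (S / (2 * v)) := by
      refine (Finset.sum_le_sum_of_subset_of_nonneg (Finset.filter_subset _ _)
        fun a _ _ => mul_nonneg (hpos a).le (Real.exp_pos _).le).trans ((hsub _).trans (le_of_eq ?_))
      congr 1
      simp only [div_pow, ← Finset.sum_div]
      rw [← hS]
      field_simp
    have hlog : Real.log P + S / v ≤ S / (2 * v) := by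
      have := Real.log_le_log (by positivity) (hjensen.trans htot)
      rwa [Real.log_mul hP.ne' (Real.exp_pos _).ne', Real.log_exp, Real.log_exp] at this
    -- The entropy is at most `log K`, by `log z ≤ z - 1` at `z = 1 / (P * K)`; the remainders `1 /
    -- K - P` have a sum that is at most zero.
    have hlog2 : Real.log (1 / (P * K)) ≤ 1 / (P * K) - 1 :=
      Real.log_le_sub_one_of_pos (by positivity)
    rw [Real.log_div one_ne_zero (by positivity), Real.log_one,
      Real.log_mul hP.ne' hK0.ne'] at hlog2
    have hSle : S ≤ 2 * v * (Real.log K + (1 / (P * K) - 1)) := by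
      have e : S / v - S / (2 * v) = S / (2 * v) := by field_simp; ring
      have : S / (2 * v) ≤ Real.log K + (1 / (P * K) - 1) := by linarith
      rw [div_le_iff₀ (by positivity)] at this
      linarith
    have e1 : ∑ j, fiberSum f (fun a => p a * s j a) y ^ 2 / P = P * S := by
      rw [hS, Finset.mul_sum]
      refine Finset.sum_congr rfl fun j _ => ?_
      simp only [hμ]
      field_simp
    rw [e1]
    calc P * S ≤ P * (2 * v * (Real.log K + (1 / (P * K) - 1))) :=
          mul_le_mul_of_nonneg_left hSle hP.le
      _ = _ := by field_simp
  refine (Finset.sum_le_sum key).trans ?_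
  rw [← Finset.mul_sum, Finset.sum_add_distrib, ← Finset.sum_mul, Finset.sum_sub_distrib,
    sum_fiberSum_one, hp, Finset.sum_const, nsmul_eq_mul]
  refine mul_le_mul_of_nonneg_left ?_ (by positivity)
  have : ((Finset.univ.image f).card : ℝ) * (1 / K) ≤ 1 := by
    rw [mul_one_div, div_le_one hK0]; exact hK
  linarith

end Partition

/-! ### Products of Bernoulli distributions -/

section Bernoulli

/-- The probability mass function of the Bernoulli distribution. -/
def bernoulliWeight (t : ℝ) (b : Bool) : ℝ := if b then t else 1 - t

/-- The derivative of `bernoulliWeight` in the parameter. -/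
def boolSign (b : Bool) : ℝ := if b then 1 else -1

/-- The score of the Bernoulli distribution. -/
def bernoulliScore (t : ℝ) (b : Bool) : ℝ := boolSign b / bernoulliWeight t b

theorem sum_bernoulliWeight (t : ℝ) : ∑ b, bernoulliWeight t b = 1 := by
  simp [bernoulliWeight]

theorem bernoulliWeight_nonneg {t : ℝ} (ht : t ∈ Set.Icc (0 : ℝ) 1) (b : Bool) :
    0 ≤ bernoulliWeight t b := by
  cases b <;> simp [bernoulliWeight, ht.1, ht.2]

theorem bernoulliWeight_pos {t : ℝ} (ht : t ∈ Set.Ioo (0 : ℝ) 1) (b : Bool) :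
    0 < bernoulliWeight t b := by
  cases b <;> simp [bernoulliWeight, ht.1, ht.2]

theorem bernoulliWeight_mul_score {t : ℝ} (ht : t ∈ Set.Ioo (0 : ℝ) 1) (b : Bool) :
    bernoulliWeight t b * bernoulliScore t b = boolSign b :=
  mul_div_cancel₀ _ (bernoulliWeight_pos ht b).ne'

theorem sum_bernoulliWeight_score {t : ℝ} (ht : t ∈ Set.Ioo (0 : ℝ) 1) :
    ∑ b, bernoulliWeight t b * bernoulliScore t b = 0 := by
  simp [bernoulliWeight_mul_score ht, boolSign]

theorem sum_bernoulliWeight_score_sq {t : ℝ} (ht : t ∈ Set.Ioo (0 : ℝ) 1) :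
    ∑ b, bernoulliWeight t b * bernoulliScore t b ^ 2 = 1 / (t * (1 - t)) := by
  have h1 : t ≠ 0 := ht.1.ne'
  have h2 : 1 - t ≠ 0 := (sub_pos.2 ht.2).ne'
  simp only [bernoulliWeight, bernoulliScore, boolSign, Fintype.sum_bool, if_true]
  simp only [Bool.false_eq_true, if_false]
  field_simp
  ring

theorem abs_bernoulliScore_le {t M : ℝ} (hM : 1 ≤ M) (h0 : 1 / M ≤ t) (h1 : t ≤ 1 - 1 / M)
    (b : Bool) : |bernoulliScore t b| ≤ M := by
  have hM0 : 0 < 1 / M := by positivity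
  have hw : 1 / M ≤ bernoulliWeight t b := by
    cases b <;> simp only [bernoulliWeight, if_true, Bool.false_eq_true, if_false] <;> linarith
  have hs : |boolSign b| = 1 := by cases b <;> simp [boolSign]
  rw [bernoulliScore, abs_div, hs, abs_of_pos (hM0.trans_le hw)]
  exact (one_div_le_one_div_of_le hM0 hw).trans (by simp)

/-- Hoeffding's lemma for the score. -/
theorem sum_bernoulliWeight_exp_score_le {t M : ℝ} (ht : t ∈ Set.Ioo (0 : ℝ) 1) (hM0 : 0 < M)
    (hM : ∀ b, |bernoulliScore t b| ≤ M) (c : ℝ) :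
    ∑ b, bernoulliWeight t b * Real.exp (c * bernoulliScore t b)
      ≤ Real.exp (M ^ 2 * c ^ 2 / 2) := by
  -- The chord of the exponential over `[-M, M]` dominates it; the slope term drops out because the
  -- score has mean zero.
  have h1 : ∀ b, bernoulliWeight t b * Real.exp (c * bernoulliScore t b)
      ≤ bernoulliWeight t b * Real.cosh (M * c)
        + Real.sinh (M * c) / M * (bernoulliWeight t b * bernoulliScore t b) := by
    intro b
    have := Real.exp_mul_le_cosh_add_mul_sinh (t := bernoulliScore t b / M)
      (by rw [abs_div, abs_of_pos hM0, div_le_one hM0]; exact hM b) (M * c)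
    have e : bernoulliScore t b / M * (M * c) = c * bernoulliScore t b := by field_simp
    rw [e] at this
    refine (mul_le_mul_of_nonneg_left this (bernoulliWeight_pos ht b).le).trans (le_of_eq ?_)
    ring
  refine (Finset.sum_le_sum fun b _ => h1 b).trans ?_
  rw [Finset.sum_add_distrib, ← Finset.sum_mul, ← Finset.mul_sum, sum_bernoulliWeight,
    sum_bernoulliWeight_score ht, mul_zero, add_zero, one_mul]
  refine (Real.cosh_le_exp_half_sq _).trans (le_of_eq ?_)
  rw [mul_pow]

variable {d : ℕ}

/-- The probability mass function of a product of Bernoulli distributions. -/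
def bernoulliProd (θ : Fin d → ℝ) (x : Fin d → Bool) : ℝ := ∏ i, bernoulliWeight (θ i) (x i)

theorem sum_bernoulliProd (θ : Fin d → ℝ) : ∑ x, bernoulliProd θ x = 1 := by
  have := prodExp_one (p := fun i => bernoulliWeight (θ i)) fun i => sum_bernoulliWeight _
  simpa [prodExp, bernoulliProd] using this

theorem bernoulliProd_pos {θ : Fin d → ℝ} (hθ : ∀ i, θ i ∈ Set.Ioo (0 : ℝ) 1) (x : Fin d → Bool) :
    0 < bernoulliProd θ x := Finset.prod_pos fun i _ => bernoulliWeight_pos (hθ i) _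

theorem bernoulliProd_nonneg {θ : Fin d → ℝ} (hθ : ∀ i, θ i ∈ Set.Icc (0 : ℝ) 1)
    (x : Fin d → Bool) : 0 ≤ bernoulliProd θ x :=
  Finset.prod_nonneg fun i _ => bernoulliWeight_nonneg (hθ i) _

/-- The score of the product in the `i`th coordinate. -/
def coordScore (θ : Fin d → ℝ) (i : Fin d) (x : Fin d → Bool) : ℝ := bernoulliScore (θ i) (x i)

theorem sum_bernoulliProd_coordScore {θ : Fin d → ℝ} (hθ : ∀ i, θ i ∈ Set.Ioo (0 : ℝ) 1)
    (i : Fin d) : ∑ x, bernoulliProd θ x * coordScore θ i x = 0 :=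
  (prodExp_coord (fun _ => sum_bernoulliWeight _) i (bernoulliScore (θ i))).trans
    (sum_bernoulliWeight_score (hθ i))

theorem sum_bernoulliProd_coordScore_sq {θ : Fin d → ℝ} (hθ : ∀ i, θ i ∈ Set.Ioo (0 : ℝ) 1)
    (i : Fin d) : ∑ x, bernoulliProd θ x * coordScore θ i x ^ 2 = 1 / (θ i * (1 - θ i)) :=
  (prodExp_coord (fun _ => sum_bernoulliWeight _) i (fun b => bernoulliScore (θ i) b ^ 2)).trans
    (sum_bernoulliWeight_score_sq (hθ i))

theorem sum_bernoulliProd_coordScore_mul {θ : Fin d → ℝ} (hθ : ∀ i, θ i ∈ Set.Ioo (0 : ℝ) 1)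
    (i j : Fin d) (hij : i ≠ j) :
    ∑ x, bernoulliProd θ x * (coordScore θ i x * coordScore θ j x) = 0 := by
  refine (prodExp_mul_coord (p := fun i => bernoulliWeight (θ i)) j (sum_bernoulliWeight _)
    (fun x => bernoulliScore (θ i) (x i))
    (fun x a => by rw [Function.update_of_ne hij]) (bernoulliScore (θ j))).trans ?_
  rw [sum_bernoulliWeight_score (hθ j), mul_zero]

theorem sum_bernoulliProd_exp_le {θ : Fin d → ℝ} (hθ : ∀ i, θ i ∈ Set.Ioo (0 : ℝ) 1) {M : ℝ}
    (hM0 : 0 < M) (hM : ∀ i b, |bernoulliScore (θ i) b| ≤ M) (c : Fin d → ℝ) :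
    ∑ x, bernoulliProd θ x * Real.exp (∑ i, c i * coordScore θ i x)
      ≤ Real.exp (M ^ 2 * (∑ i, c i ^ 2) / 2) := by
  have h1 : ∑ x, bernoulliProd θ x * Real.exp (∑ i, c i * coordScore θ i x)
      = ∏ i, ∑ b, bernoulliWeight (θ i) b * Real.exp (c i * bernoulliScore (θ i) b) := by
    have := sum_piFinset_prod_mul (fun _ : Fin d => (Finset.univ : Finset Bool))
      (fun i => bernoulliWeight (θ i)) (fun i b => Real.exp (c i * bernoulliScore (θ i) b))
    rw [← this, Fintype.piFinset_univ]
    simp only [Real.exp_sum]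
    rfl
  rw [h1, Finset.mul_sum, Finset.sum_div, Real.exp_sum]
  exact Finset.prod_le_prod
    (fun i _ => Finset.sum_nonneg fun b _ =>
      mul_nonneg (bernoulliWeight_pos (hθ i) b).le (Real.exp_pos _).le)
    fun i _ => sum_bernoulliWeight_exp_score_le (hθ i) hM0 (hM i) (c i)

end Bernoulli

/-! ### The risk as a finite sum -/

section Risk

variable {n k d : ℕ}

theorem bernoulliMeasure_singleton (t : unitInterval) (b : Bool) :
    bernoulliMeasure true false t {b} = ENNReal.ofReal (bernoulliWeight t b) := by
  cases b
  · rw [bernoulliMeasure_apply_of_notMem_of_mem t (measurableSet_singleton _) (by simp) (by simp)]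
    exact (ENNReal.ofReal_eq_coe_nnreal (unitInterval.symm t).2.1).symm
  · rw [bernoulliMeasure_apply_of_mem_of_notMem t (measurableSet_singleton _) (by simp) (by simp)]
    exact (ENNReal.ofReal_eq_coe_nnreal t.2.1).symm

theorem productBernoulli_singleton (θ : Fin d → unitInterval) (x : Fin d → Bool) :
    productBernoulli θ {x} = ENNReal.ofReal (bernoulliProd (fun i => θ i) x) := by
  rw [productBernoulli, ← Set.univ_pi_singleton, Measure.pi_pi, bernoulliProd,
    ENNReal.ofReal_prod_of_nonneg fun i _ => bernoulliWeight_nonneg (θ i).2 _]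
  simp only [bernoulliMeasure_singleton]

instance (θ : Fin d → unitInterval) : IsProbabilityMeasure (productBernoulli θ) := by
  unfold productBernoulli; infer_instance

/-- The expectation over `n` samples of a nonnegative function. -/
theorem lintegral_samples (θ : Fin d → unitInterval) (F : (Fin n → Fin d → Bool) → ℝ)
    (hF : ∀ x, 0 ≤ F x) :
    ∫⁻ x, ENNReal.ofReal (F x) ∂(Measure.pi fun _ : Fin n => productBernoulli θ)
      = ENNReal.ofReal (prodExp (fun _ => bernoulliProd fun i => θ i) F) := by
  have hP : ∀ x : Fin d → Bool, 0 ≤ bernoulliProd (fun i => (θ i : ℝ)) x :=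
    bernoulliProd_nonneg fun i => (θ i).2
  rw [lintegral_fintype, prodExp, ENNReal.ofReal_sum_of_nonneg fun x _ =>
    mul_nonneg (Finset.prod_nonneg fun i _ => hP _) (hF x)]
  refine Finset.sum_congr rfl fun x _ => ?_
  rw [← Set.univ_pi_singleton, Measure.pi_pi, ENNReal.ofReal_mul
    (Finset.prod_nonneg fun i _ => hP _), ENNReal.ofReal_prod_of_nonneg fun i _ => hP _, mul_comm]
  simp only [productBernoulli_singleton]

end Risk

/-! ### Measurability in the public randomness -/

section Seed

variable {n k : ℕ} {X : Type}

theorem PublicCoinProtocol.measurableSet_board (P : PublicCoinProtocol n k X) (x : Fin n → X)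
    (t : ℕ) (y : List Bool) : MeasurableSet {ω | (P.protocol ω).board x t = y} := by
  induction t generalizing y with
  | zero =>
    simp only [BlackboardProtocol.board]
    exact MeasurableSet.const _
  | succ t ih =>
    rcases List.eq_nil_or_concat' y with rfl | ⟨h, b, rfl⟩
    · simp [BlackboardProtocol.board]
    · have : {ω | (P.protocol ω).board x (t + 1) = h ++ [b]}
          = {ω | (P.protocol ω).board x t = h} ∩ ⋃ i, ({ω | (P.protocol ω).speaker h = i} ∩
            {ω | (P.protocol ω).bit h (x i) = b}) := by
        ext ω
        simp only [BlackboardProtocol.board, Set.mem_ofPred_eq, Set.mem_inter_iff, Set.mem_iUnion]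
        constructor
        · intro e
          obtain ⟨rfl, e2⟩ := List.append_inj' e rfl
          exact ⟨rfl, _, rfl, by simpa using e2⟩
        · rintro ⟨rfl, i, rfl, rfl⟩
          rfl
      rw [this]
      exact (ih h).inter (MeasurableSet.iUnion fun i =>
        (P.measurable_speaker h (measurableSet_singleton i)).inter
          (P.measurable_bit h (x i) (measurableSet_singleton b)))

/-- There are countably many transcripts, so the estimate is glued from countably many measurable
pieces. Tonelli's theorem for seed and prior relies on this. -/
theorem PublicCoinProtocol.measurable_estimate {β : Type*} [MeasurableSpace β]
    (P : PublicCoinProtocol n k X) (est : P.Seed → List Bool → β)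
    (hest : ∀ y, Measurable fun ω => est ω y) (x : Fin n → X) :
    Measurable fun ω => est ω ((P.protocol ω).transcript x) := by
  intro s hs
  have : (fun ω => est ω ((P.protocol ω).transcript x)) ⁻¹' s
      = ⋃ y, ({ω | (P.protocol ω).transcript x = y} ∩ (fun ω => est ω y) ⁻¹' s) := by
    ext ω; simp
  rw [this]
  exact MeasurableSet.iUnion fun y => (P.measurableSet_board x _ y).inter (hest y hs)

end Seed

/-! ### Bayesian lower bounds -/

section Lower

variable {n k d m : ℕ}

/-- The derivative of the product of Bernoulli distributions along the direction `D`. -/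
def bernoulliProdDeriv (θ D : Fin d → ℝ) (x : Fin d → Bool) : ℝ :=
  ∑ i, (∏ l ∈ Finset.univ.erase i, bernoulliWeight (θ l) (x l)) * (boolSign (x i) * D i)

theorem hasDerivAt_bernoulliWeight {f : ℝ → ℝ} {f' t : ℝ} (hf : HasDerivAt f f' t) (b : Bool) :
    HasDerivAt (fun t => bernoulliWeight (f t) b) (boolSign b * f') t := by
  cases b
  · simpa [bernoulliWeight, boolSign] using hf.const_sub 1
  · simpa [bernoulliWeight, boolSign] using hf

theorem hasDerivAt_bernoulliProd {f : ℝ → Fin d → ℝ} {D : Fin d → ℝ} {t : ℝ}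
    (hf : ∀ i, HasDerivAt (fun t => f t i) (D i) t) (x : Fin d → Bool) :
    HasDerivAt (fun t => bernoulliProd (f t) x) (bernoulliProdDeriv (f t) D x) t := by
  have := HasDerivAt.fun_finsetProd (u := Finset.univ)
    fun i _ => hasDerivAt_bernoulliWeight (hf i) (x i)
  simp only [smul_eq_mul] at this
  exact this

theorem continuous_bernoulliWeight (b : Bool) : Continuous fun t => bernoulliWeight t b := by
  cases b <;> simp only [bernoulliWeight, if_true, Bool.false_eq_true, if_false] <;> fun_prop

theorem continuous_bernoulliProd (x : Fin d → Bool) : Continuous fun θ => bernoulliProd θ x :=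
  continuous_finsetProd _ fun i _ => (continuous_bernoulliWeight _).comp (continuous_apply i)

theorem continuous_bernoulliProdDeriv (D : Fin d → ℝ) (x : Fin d → Bool) :
    Continuous fun θ => bernoulliProdDeriv θ D x :=
  continuous_finsetSum _ fun _ _ => (continuous_finsetProd _ fun l _ =>
    (continuous_bernoulliWeight _).comp (continuous_apply l)).mul continuous_const

/-- The division-free derivative is continuous for all real `θ`, as `vanTrees` requires; it takes
the score form only where all weights are positive. -/
theorem bernoulliProdDeriv_eq {θ : Fin d → ℝ} (hθ : ∀ i, θ i ∈ Set.Ioo (0 : ℝ) 1) (D : Fin d → ℝ)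
    (x : Fin d → Bool) :
    bernoulliProdDeriv θ D x = bernoulliProd θ x * ∑ i, D i * coordScore θ i x := by
  rw [bernoulliProdDeriv, Finset.mul_sum]
  refine Finset.sum_congr rfl fun i _ => ?_
  rw [bernoulliProd, ← Finset.mul_prod_erase _ _ (Finset.mem_univ i),
    ← bernoulliWeight_mul_score (hθ i), coordScore]
  ring

/-- The Bayes risk, for the uniform prior on the cube and a deterministic protocol. -/
theorem bayesRisk_ge (θ : (Fin m → ℝ) → Fin d → ℝ) (D : Fin m → Fin d → ℝ) (hθc : Continuous θ)
    (hθD : ∀ u j t i, θ (Function.update u j t) i = θ u i + (t - u j) * D j i)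
    (hθ : ∀ u, (∀ j, u j ∈ Set.Icc (0 : ℝ) 1) → ∀ i, θ u i ∈ Set.Ioo (0 : ℝ) 1) {b : ℝ}
    (hb0 : 0 ≤ b)
    (hb : ∀ u, (∀ j, u j ∈ Set.Icc (0 : ℝ) 1) → ∀ f : (Fin d → Bool) → List Bool,
      (Finset.univ.image f).card ≤ 2 ^ k → ∑ j, fisherInfo f (bernoulliProd (θ u))
        (fun x => bernoulliProd (θ u) x * ∑ i, D j i * coordScore (θ u) i x) ≤ b)
    (P : BlackboardProtocol n k (Fin d → Bool)) (T : List Bool → Fin m → ℝ) :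
    (m : ℝ) ^ 2 / (36 * (m + n * b)) ≤
      ∫ u, prodExp (fun _ => bernoulliProd (θ u))
        (fun x => ∑ j, (T (P.transcript x) j - u j) ^ 2) ∂cubeMeasure m := by
  set Q' : Fin m → (Fin m → ℝ) → (Fin n → Fin d → Bool) → ℝ := fun j u x =>
    ∑ r, (∏ l ∈ Finset.univ.erase r, bernoulliProd (θ u) (x l)) *
      bernoulliProdDeriv (θ u) (D j) (x r) with hQ'
  refine vanTrees (fun u x => ∏ r, bernoulliProd (θ u) (x r)) Q' ?_ ?_ ?_ ?_ ?_ P.transcript T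
    (n * b) (by positivity) ?_
  · exact fun x => continuous_finsetProd _ fun r _ => (continuous_bernoulliProd _).comp hθc
  · exact fun j x => continuous_finsetSum _ fun r _ => (continuous_finsetProd _ fun l _ =>
      (continuous_bernoulliProd _).comp hθc).mul ((continuous_bernoulliProdDeriv _ _).comp hθc)
  · intro u j x
    have h1 : ∀ i, HasDerivAt (fun t => θ (Function.update u j t) i) (D j i) (u j) := by
      intro i
      simp only [hθD]
      have := (((hasDerivAt_id' (u j)).sub_const (u j)).mul_const (D j i)).const_add (θ u i)
      simpa using this
    have h2 := HasDerivAt.fun_finsetProd (u := Finset.univ)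
      fun r _ => hasDerivAt_bernoulliProd h1 (x r)
    simpa only [smul_eq_mul, Function.update_eq_self] using h2
  · intro u
    have := prodExp_one (p := fun _ : Fin n => bernoulliProd (θ u))
      fun _ => sum_bernoulliProd _
    simpa [prodExp] using this
  · exact fun u hu x => Finset.prod_pos fun r _ => bernoulliProd_pos (hθ u hu) _
  · intro u hu
    have hQ : ∀ j, Q' j u = fun x => (∏ r, bernoulliProd (θ u) (x r)) *
        ∑ r, ∑ i, D j i * coordScore (θ u) i (x r) := by
      intro j
      ext x
      simp only [hQ']
      rw [Finset.mul_sum]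
      refine Finset.sum_congr rfl fun r _ => ?_
      rw [← Finset.mul_prod_erase _ _ (Finset.mem_univ r), bernoulliProdDeriv_eq (hθ u hu)]
      ring
    simp only [hQ]
    have hA : ∃ A : List Bool → Fin n → Finset (Fin d → Bool), ∀ x₀ x,
        P.transcript x = P.transcript x₀ ↔ ∀ i, x i ∈ A (P.transcript x₀) i := by
      classical
      refine ⟨fun y i => Finset.univ.filter fun a => P.Consistent (n * k) y i a, fun x₀ x => ?_⟩
      simp only [Finset.mem_filter, Finset.mem_univ, true_and]
      exact P.board_eq_iff x₀ x (n * k)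
    obtain ⟨A, hA⟩ := hA
    have := sum_fisherInfo_le (bernoulliProd (θ u))
      (fun j x => ∑ i, D j i * coordScore (θ u) i x) (bernoulliProd_pos (hθ u hu))
      (sum_bernoulliProd _) ?_ P.transcript A hA (2 ^ k) P.card_transcripts_le b (hb u hu)
    · simpa using this
    · intro j
      simp only [Finset.mul_sum]
      rw [Finset.sum_comm]
      refine Finset.sum_eq_zero fun i _ => ?_
      have h0 := sum_bernoulliProd_coordScore (hθ u hu) i
      calc _ = D j i * ∑ x, bernoulliProd (θ u) x * coordScore (θ u) i x := by
            rw [Finset.mul_sum]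
            exact Finset.sum_congr rfl fun x _ => by ring
        _ = 0 := by rw [h0, mul_zero]

/-- The supremum of the risk dominates its average over the prior, and after exchanging the
integrals the Bayes bound applies for each seed separately. `τ` and `κ` turn an estimate of `θ u`
into one of `u`. -/
theorem minimaxRiskPublic_ge (Θ : Set (Fin d → unitInterval)) (θ : (Fin m → ℝ) → Fin d → ℝ)
    (D : Fin m → Fin d → ℝ) (hθc : Continuous θ)
    (hθD : ∀ u j t i, θ (Function.update u j t) i = θ u i + (t - u j) * D j i)
    (hθ : ∀ u, (∀ j, u j ∈ Set.Icc (0 : ℝ) 1) → ∀ i, θ u i ∈ Set.Ioo (0 : ℝ) 1)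
    (hΘ : ∀ u, (∀ j, u j ∈ Set.Icc (0 : ℝ) 1) → ∀ ϑ : Fin d → unitInterval,
      (∀ i, (ϑ i : ℝ) = θ u i) → ϑ ∈ Θ) {b : ℝ} (hb0 : 0 ≤ b)
    (hb : ∀ u, (∀ j, u j ∈ Set.Icc (0 : ℝ) 1) → ∀ f : (Fin d → Bool) → List Bool,
      (Finset.univ.image f).card ≤ 2 ^ k → ∑ j, fisherInfo f (bernoulliProd (θ u))
        (fun x => bernoulliProd (θ u) x * ∑ i, D j i * coordScore (θ u) i x) ≤ b)
    (τ : (Fin d → ℝ) → Fin m → ℝ) (hτ : Continuous τ) {κ : ℝ} (hκ : 0 ≤ κ)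
    (hloss : ∀ u (a : Fin d → ℝ), κ * ∑ j, (τ a j - u j) ^ 2 ≤ ∑ i, (a i - θ u i) ^ 2) :
    ENNReal.ofReal (κ * (m ^ 2 / (36 * (m + n * b)))) ≤ blackboardMinimaxRiskPublic n k Θ := by
  refine le_iInf fun P => le_iInf fun est => le_iInf fun hest => ?_
  set M := ⨆ ϑ ∈ Θ, blackboardRisk P est ϑ with hM
  set Φ : P.Seed → (Fin m → ℝ) → ℝ := fun ω u => prodExp (fun _ : Fin n => bernoulliProd (θ u))
    (fun x => ∑ j, (τ (est ω ((P.protocol ω).transcript x)) j - u j) ^ 2) with hΦ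
  have hΦm : Measurable fun q : (Fin m → ℝ) × P.Seed => Φ q.2 q.1 := by
    simp only [hΦ, prodExp]
    refine Finset.measurable_sum _ fun x _ => Measurable.mul ?_ ?_
    · refine Finset.measurable_prod _ fun r _ => ?_
      exact ((continuous_bernoulliProd (x r)).comp hθc).measurable.comp measurable_fst
    · refine Finset.measurable_sum _ fun j _ => ?_
      have h1 : Measurable fun ω => τ (est ω ((P.protocol ω).transcript x)) :=
        hτ.measurable.comp (P.measurable_estimate est hest x)
      have h2 : Measurable fun ω => τ (est ω ((P.protocol ω).transcript x)) j :=
        (measurable_pi_apply j).comp h1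
      have h3 : Measurable fun q : (Fin m → ℝ) × P.Seed => q.1 j :=
        (measurable_pi_apply j).comp measurable_fst
      exact ((h2.comp measurable_snd).sub h3).pow_const 2
  have hle : ∀ᵐ u ∂cubeMeasure m, ∫⁻ ω, ENNReal.ofReal (κ * Φ ω u) ∂P.law ≤ M := by
    filter_upwards [ae_mem_cube] with u hu
    set ϑ : Fin d → unitInterval := fun i => ⟨θ u i, Set.Ioo_subset_Icc_self (hθ u hu i)⟩
    refine le_trans ?_ (le_iSup₂ (f := fun ϑ (_ : ϑ ∈ Θ) => blackboardRisk P est ϑ) ϑ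
      (hΘ u hu ϑ fun i => rfl))
    refine lintegral_mono fun ω => ?_
    simp only [squaredLoss]
    rw [lintegral_samples ϑ _ fun x => Finset.sum_nonneg fun j _ => sq_nonneg _]
    refine ENNReal.ofReal_le_ofReal ?_
    simp only [hΦ]
    rw [← prodExp_mul_left]
    exact prodExp_mono (fun _ => bernoulliProd_nonneg fun i => (ϑ i).2) fun x => hloss u _
  calc ENNReal.ofReal (κ * (m ^ 2 / (36 * (m + n * b))))
      = ∫⁻ _ω, ENNReal.ofReal (κ * (m ^ 2 / (36 * (m + n * b)))) ∂P.law := by simp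
    _ ≤ ∫⁻ ω, ∫⁻ u, ENNReal.ofReal (κ * Φ ω u) ∂cubeMeasure m ∂P.law := by
        refine lintegral_mono fun ω => ?_
        have hc : Continuous (Φ ω) := by
          simp only [hΦ, prodExp]
          refine continuous_finsetSum _ fun x _ => Continuous.mul ?_ (by fun_prop)
          exact continuous_finsetProd _ fun r _ => (continuous_bernoulliProd _).comp hθc
        rw [← ofReal_integral_eq_lintegral_ofReal ((integrable_cubeMeasure hc).const_mul κ) ?_]
        · refine ENNReal.ofReal_le_ofReal ?_
          rw [integral_const_mul]
          exact mul_le_mul_of_nonneg_left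
            (bayesRisk_ge θ D hθc hθD hθ hb0 hb (P.protocol ω) fun y => τ (est ω y)) hκ
        · filter_upwards [ae_mem_cube] with u hu
          exact mul_nonneg hκ (prodExp_nonneg
            (fun _ => bernoulliProd_nonneg fun i => Set.Ioo_subset_Icc_self (hθ u hu i))
            fun x => Finset.sum_nonneg fun j _ => sq_nonneg _)
    _ = ∫⁻ u, ∫⁻ ω, ENNReal.ofReal (κ * Φ ω u) ∂P.law ∂cubeMeasure m := by
        rw [lintegral_lintegral_swap]
        have := (hΦm.const_mul κ).ennreal_ofReal
        exact (this.comp measurable_swap).aemeasurable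
    _ ≤ ∫⁻ _u, M ∂cubeMeasure m := lintegral_mono_ae hle
    _ = M := by simp

end Lower

/-! ### Least favourable families on the cube and on the simplex -/

section LowerInstances

theorem fisherInfo_const_mul {α L : Type*} [Fintype α] [DecidableEq L] (f : α → L) (p s : α → ℝ)
    (c : ℝ) :
    fisherInfo f p (fun a => p a * (c * s a)) = c ^ 2 * fisherInfo f p (fun a => p a * s a) := by
  unfold fisherInfo
  rw [Finset.mul_sum]
  refine Finset.sum_congr rfl fun y _ => ?_
  have : fiberSum f (fun a => p a * (c * s a)) y = c * fiberSum f (fun a => p a * s a) y := by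
    simp only [fiberSum, Finset.mul_sum]
    exact Finset.sum_congr rfl fun a _ => by ring
  rw [this]; ring

theorem fisherInfo_nonneg {α L : Type*} [Fintype α] [DecidableEq L] (f : α → L) {p : α → ℝ}
    (hp : ∀ a, 0 < p a) (p' : α → ℝ) : 0 ≤ fisherInfo f p p' :=
  Finset.sum_nonneg fun _ hy => div_nonneg (sq_nonneg _) (fiberSum_pos hp hy).le

theorem fisherInfo_sub_le {α L : Type*} [Fintype α] [DecidableEq L] (f : α → L) {p : α → ℝ}
    (hp : ∀ a, 0 < p a) (s t : α → ℝ) :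
    fisherInfo f p (fun a => p a * (s a - t a)) ≤
      2 * (fisherInfo f p (fun a => p a * s a) + fisherInfo f p (fun a => p a * t a)) := by
  unfold fisherInfo
  rw [← Finset.sum_add_distrib, Finset.mul_sum]
  refine Finset.sum_le_sum fun y hy => ?_
  have : fiberSum f (fun a => p a * (s a - t a)) y
      = fiberSum f (fun a => p a * s a) y - fiberSum f (fun a => p a * t a) y := by
    simp only [fiberSum, mul_sub, Finset.sum_sub_distrib]
  rw [this, ← add_div, ← mul_div_assoc]
  refine div_le_div_of_nonneg_right ?_ (fiberSum_pos hp hy).le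
  nlinarith [sq_nonneg (fiberSum f (fun a => p a * s a) y + fiberSum f (fun a => p a * t a) y)]

variable {n k d : ℕ}

theorem max_div_eq_div_min {x y z : ℝ} (hx : 0 < x) (hy : 0 < y) (hz : 0 ≤ z) :
    max (z / x) (z / y) = z / min x y := by
  rcases le_total x y with h | h
  · rw [min_eq_left h, max_eq_left (div_le_div_of_nonneg_left hz hx h)]
  · rw [min_eq_right h, max_eq_right (div_le_div_of_nonneg_left hz hy h)]

theorem cube_minimaxRisk_ge (hd : 1 ≤ d) (hk : 1 ≤ k)
    (hn : (d : ℝ) ^ 2 / min (d : ℝ) (k : ℝ) ≤ n) :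
    ENNReal.ofReal (1 / 1296 * max ((d : ℝ) ^ 2 / (n * k)) ((d : ℝ) / n)) ≤
      blackboardMinimaxRiskPublic n k (Set.univ : Set (Fin d → unitInterval)) := by
  have hd1 : (1 : ℝ) ≤ d := by exact_mod_cast hd
  have hk1 : (1 : ℝ) ≤ k := by exact_mod_cast hk
  set μ : ℝ := min (d : ℝ) k with hμ
  have hμ1 : 1 ≤ μ := le_min hd1 hk1
  rw [div_le_iff₀ (by linarith)] at hn
  have hn0 : (0 : ℝ) < n := by
    by_contra h
    nlinarith [mul_nonneg (neg_nonneg.2 (not_lt.1 h)) (by linarith : (0 : ℝ) ≤ μ)]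
  have hD : ∀ (j : Fin d) (g : Fin d → ℝ),
      ∑ i, (if i = j then (1 / 2 : ℝ) else 0) * g i = 1 / 2 * g j := by
    intro j g
    simp
  refine le_trans ?_ (minimaxRiskPublic_ge (n := n) (k := k) Set.univ
    (fun u i => 1 / 4 + u i / 2) (fun j i => if i = j then 1 / 2 else 0) (by fun_prop) ?_ ?_
    (fun _ _ _ _ => Set.mem_univ _) (b := 8 * μ) (by linarith) ?_
    (fun a j => 2 * (a j - 1 / 4)) (by fun_prop) (κ := 1 / 4) (by norm_num) ?_)
  · refine ENNReal.ofReal_le_ofReal ?_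
    have e : max ((d : ℝ) ^ 2 / (n * k)) ((d : ℝ) / n) = (d : ℝ) ^ 2 / (n * μ) := by
      have : (d : ℝ) / n = (d : ℝ) ^ 2 / (n * d) := by field_simp
      rw [this, max_div_eq_div_min (by positivity) (by positivity) (by positivity), hμ,
        ← mul_min_of_nonneg _ _ hn0.le, min_comm]
    rw [e, div_mul_div_comm, div_mul_div_comm]
    refine div_le_div_of_nonneg_left (by positivity) (by positivity) ?_
    -- The condition on `n` gives `d ≤ d ^ 2 ≤ n * μ`, which absorbs the term of the prior; `4 * 36
    -- * (1 + 8) = 1296`.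
    nlinarith
  · intro u j t i
    by_cases h : i = j
    · subst h
      simp only [Function.update_self, if_true]
      ring
    · simp [h]
  · intro u hu i
    have := hu i
    constructor <;> linarith [this.1, this.2]
  · intro u hu f hf
    have hu4 : ∀ i, 1 / 4 ≤ 1 / 4 + u i / 2 ∧ 1 / 4 + u i / 2 ≤ 3 / 4 := fun i => by
      constructor <;> linarith [(hu i).1, (hu i).2]
    have hθ : ∀ i, 1 / 4 + u i / 2 ∈ Set.Ioo (0 : ℝ) 1 := fun i => by
      constructor <;> linarith [(hu4 i).1, (hu4 i).2]
    have hpos := bernoulliProd_pos hθ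
    simp only [hD, fisherInfo_const_mul]
    rw [← Finset.mul_sum]
    -- Each variance is at most `16 / 3`; the value `32` is chosen to match the sub-Gaussian bound
    -- `2 * 4 ^ 2 * log (2 ^ k) ≤ 32 * k`.
    have h1 : ∑ j, fisherInfo f (bernoulliProd fun i => 1 / 4 + u i / 2)
        (fun x => bernoulliProd (fun i => 1 / 4 + u i / 2) x *
          coordScore (fun i => 1 / 4 + u i / 2) j x) ≤ 32 * d := by
      calc _ ≤ ∑ _j : Fin d, (32 : ℝ) := by
            refine Finset.sum_le_sum fun j _ => (fisherInfo_le_variance _ _ hpos f).trans ?_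
            rw [sum_bernoulliProd_coordScore_sq hθ]
            obtain ⟨h1, h2⟩ := hu4 j
            rw [div_le_iff₀ (mul_pos (by linarith) (by linarith))]
            nlinarith [mul_nonneg (sub_nonneg.2 h1) (sub_nonneg.2 h2)]
        _ = 32 * d := by simp [mul_comm]
    have h2 := sum_fisherInfo_le_log (bernoulliProd fun i => 1 / 4 + u i / 2)
      (coordScore fun i => 1 / 4 + u i / 2) hpos (sum_bernoulliProd _) (v := 4 ^ 2) (by norm_num)
      (sum_bernoulliProd_exp_le hθ (by norm_num) fun i b => abs_bernoulliScore_le (by norm_num)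
        (hu4 i).1 (by linarith [(hu4 i).2]) b) f (K := 2 ^ k) (by positivity) (by exact_mod_cast hf)
    rw [Real.log_pow] at h2
    have h3 : Real.log 2 ≤ 1 := by linarith [Real.log_le_sub_one_of_pos (zero_lt_two (α := ℝ))]
    have h4 : (k : ℝ) * Real.log 2 ≤ k := by nlinarith
    have h5 : ∑ j, fisherInfo f (bernoulliProd fun i => 1 / 4 + u i / 2)
        (fun x => bernoulliProd (fun i => 1 / 4 + u i / 2) x *
          coordScore (fun i => 1 / 4 + u i / 2) j x) ≤ 32 * μ := by
      rw [hμ, mul_min_of_nonneg _ _ (by norm_num)]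
      exact le_min h1 (by linarith)
    linarith
  · intro u a
    rw [Finset.mul_sum]
    refine Finset.sum_le_sum fun j _ => le_of_eq ?_
    ring

theorem sum_comp_le_sum {m d : ℕ} {e : Fin m ⊕ Fin m → Fin d} (he : Function.Injective e)
    {F : Fin d → ℝ} (hF : ∀ i, 0 ≤ F i) :
    ∑ j, (F (e (Sum.inl j)) + F (e (Sum.inr j))) ≤ ∑ i, F i := by
  rw [Finset.sum_add_distrib, ← Fintype.sum_sum_type fun s => F (e s),
    ← Finset.sum_image (g := e) (f := F) fun _ _ _ _ h => he h]
  exact Finset.sum_le_sum_of_subset_of_nonneg (Finset.subset_univ _) fun i _ _ => hF i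

/-- The pairs are disjoint, so the differences carry at most twice the total information of the
coordinate scores. -/
theorem sum_fisherInfo_pairs_le {m : ℕ} {θ : Fin d → ℝ} (hθ : ∀ i, θ i ∈ Set.Ioo (0 : ℝ) 1) {V : ℝ}
    (hV0 : 0 ≤ V) (hV : ∀ i, 1 / (θ i * (1 - θ i)) ≤ V) {e : Fin m ⊕ Fin m → Fin d}
    (he : Function.Injective e) (f : (Fin d → Bool) → List Bool)
    (hf : (Finset.univ.image f).card ≤ 2 ^ k) (c : ℝ) :
    ∑ j, fisherInfo f (bernoulliProd θ) (fun x => bernoulliProd θ x *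
      (c * (coordScore θ (e (Sum.inl j)) x - coordScore θ (e (Sum.inr j)) x)))
      ≤ c ^ 2 * (2 * (V * min (d : ℝ) (2 ^ k))) := by
  have hpos := bernoulliProd_pos hθ
  set F : Fin d → ℝ := fun i => fisherInfo f (bernoulliProd θ)
    (fun x => bernoulliProd θ x * coordScore θ i x) with hF
  have hvar : ∀ i, ∑ x, bernoulliProd θ x * coordScore θ i x ^ 2 ≤ V := fun i => by
    rw [sum_bernoulliProd_coordScore_sq hθ]
    exact hV i
  have hF1 : ∑ i, F i ≤ V * d := by
    calc _ ≤ ∑ _i : Fin d, V :=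
          Finset.sum_le_sum fun i _ => (fisherInfo_le_variance _ _ hpos f).trans (hvar i)
      _ = V * d := by simp [mul_comm]
  have hF2 : ∑ i, F i ≤ V * 2 ^ k := by
    refine (sum_fisherInfo_le_card _ (coordScore θ) hpos hV0
      (sum_bernoulliProd_coordScore_mul hθ) hvar f).trans ?_
    rw [mul_comm]
    refine mul_le_mul_of_nonneg_left ?_ hV0
    exact_mod_cast hf
  have hF3 : ∑ i, F i ≤ V * min (d : ℝ) (2 ^ k) := by
    rw [mul_min_of_nonneg _ _ hV0]
    exact le_min hF1 hF2
  calc _ ≤ ∑ j, c ^ 2 * (2 * (F (e (Sum.inl j)) + F (e (Sum.inr j)))) := by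
        refine Finset.sum_le_sum fun j _ => ?_
        rw [fisherInfo_const_mul f (bernoulliProd θ)
          fun x => coordScore θ (e (Sum.inl j)) x - coordScore θ (e (Sum.inr j)) x]
        exact mul_le_mul_of_nonneg_left (fisherInfo_sub_le f hpos (coordScore θ (e (Sum.inl j)))
          (coordScore θ (e (Sum.inr j)))) (sq_nonneg c)
    _ ≤ _ := by
        rw [← Finset.mul_sum, ← Finset.mul_sum]
        have hF0 : ∀ i, 0 ≤ F i := fun i => fisherInfo_nonneg f hpos _
        exact mul_le_mul_of_nonneg_left (mul_le_mul_of_nonneg_left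
          ((sum_comp_le_sum he hF0).trans hF3) two_pos.le) (sq_nonneg c)

/-- Around the uniform point `1 / d`, each `u j` moves mass between the two coordinates of its own
pair, which keeps the total equal to one. -/
theorem simplex_minimaxRisk_ge (hd : 2 ≤ d)
    (hn : (d : ℝ) ^ 2 / min (d : ℝ) ((2 : ℝ) ^ k) ≤ n) :
    ENNReal.ofReal (1 / 5508 * max ((d : ℝ) / (n * 2 ^ k)) (1 / n)) ≤
      blackboardMinimaxRiskPublic n k (simplexParameters d) := by
  have hd2 : (2 : ℝ) ≤ d := by exact_mod_cast hd
  have hd0 : (0 : ℝ) < d := by linarith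
  set μ : ℝ := min (d : ℝ) (2 ^ k) with hμ
  have hμ1 : 1 ≤ μ := le_min (by linarith) (one_le_pow₀ (by norm_num))
  rw [div_le_iff₀ (by linarith)] at hn
  have hn0 : (0 : ℝ) < n := by
    by_contra h
    nlinarith [mul_nonneg (neg_nonneg.2 (not_lt.1 h)) (by linarith : (0 : ℝ) ≤ μ)]
  -- For odd `d` the last coordinate is in no pair and stays at `1 / d`.
  set m : ℕ := d / 2 with hm
  have hm1 : 1 ≤ m := by omega
  have hmd : (d : ℝ) ≤ 3 * m := by exact_mod_cast (by omega : d ≤ 3 * m)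
  have hmd' : (m : ℝ) ≤ d := by exact_mod_cast (by omega : m ≤ d)
  have hm0 : (0 : ℝ) < m := by exact_mod_cast hm1
  let e : Fin m ⊕ Fin m → Fin d := Sum.elim (fun j => ⟨j, by omega⟩) (fun j => ⟨m + j, by omega⟩)
  have he : Function.Injective e := by
    rintro (i | i) (j | j) h <;> simp [e, Fin.ext_iff] at h ⊢ <;> omega
  set lo : Fin m → Fin d := fun j => e (Sum.inl j) with hlo
  set hi : Fin m → Fin d := fun j => e (Sum.inr j) with hhi
  set δ : Fin d → Fin d → ℝ := fun i l => if i = l then 1 else 0 with hδ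
  set D : Fin m → Fin d → ℝ := fun j i => (δ i (lo j) - δ i (hi j)) / d with hD
  have hδsum : ∀ (l : Fin d) (g : Fin d → ℝ), ∑ i, δ i l * g i = g l := by
    intro l g
    simp [hδ]
  have hDsum : ∀ (j : Fin m) (g : Fin d → ℝ), ∑ i, D j i * g i = (g (lo j) - g (hi j)) / d := by
    intro j g
    rw [← hδsum (lo j) g, ← hδsum (hi j) g, ← Finset.sum_sub_distrib, Finset.sum_div]
    exact Finset.sum_congr rfl fun i _ => by simp only [hD]; ring
  have hDlo : ∀ (j : Fin m) (g : Fin m → ℝ), ∑ j', D j' (lo j) * g j' = g j / d := by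
    intro j g
    rw [Finset.sum_eq_single j]
    · have h1 : lo j ≠ hi j := fun h => by simpa using he h
      simp only [hD, hδ, if_true, if_neg h1]
      ring
    · intro j' _ hj'
      have h1 : lo j ≠ lo j' := fun h => hj' (by simpa using (he h).symm)
      have h2 : lo j ≠ hi j' := fun h => by simpa using he h
      simp [hD, hδ, h1, h2]
    · simp
  set θ : (Fin m → ℝ) → Fin d → ℝ := fun u i => 1 / d + ∑ j, D j i * (u j - 1 / 2) with hθdef
  have hθbd : ∀ u : Fin m → ℝ, (∀ j, u j ∈ Set.Icc (0 : ℝ) 1) → ∀ i,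
      1 / (2 * d) ≤ θ u i ∧ θ u i ≤ 3 / (2 * d) := by
    intro u hu i
    have h1 : |∑ j, D j i * (u j - 1 / 2)| ≤ 1 / (2 * d) := by
      calc _ ≤ ∑ j, |D j i * (u j - 1 / 2)| := Finset.abs_sum_le_sum_abs _ _
        _ ≤ ∑ j, 1 / (2 * d) * (δ i (lo j) + δ i (hi j)) := by
            refine Finset.sum_le_sum fun j _ => ?_
            have h2 : |u j - 1 / 2| ≤ 1 / 2 :=
              abs_le.2 ⟨by linarith [(hu j).1], by linarith [(hu j).2]⟩
            have h3 : |D j i| ≤ (δ i (lo j) + δ i (hi j)) / d := by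
              simp only [hD]
              rw [abs_div, abs_of_pos hd0]
              refine div_le_div_of_nonneg_right ?_ hd0.le
              simp only [hδ]
              split_ifs <;> norm_num
            rw [abs_mul]
            calc _ ≤ (δ i (lo j) + δ i (hi j)) / d * (1 / 2) :=
                  mul_le_mul h3 h2 (abs_nonneg _) ((abs_nonneg _).trans h3)
              _ = _ := by ring
        _ ≤ 1 / (2 * d) * 1 := by
            rw [← Finset.mul_sum]
            refine mul_le_mul_of_nonneg_left ?_ (by positivity)
            refine (sum_comp_le_sum he (F := δ i) fun l => ?_).trans ?_
            · simp only [hδ]; split_ifs <;> norm_num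
            · simp [hδ]
        _ = 1 / (2 * d) := mul_one _
    have h4 := abs_le.1 h1
    have h5 : (1 : ℝ) / d - 1 / (2 * d) = 1 / (2 * d) := by field_simp; ring
    have h6 : (1 : ℝ) / d + 1 / (2 * d) = 3 / (2 * d) := by field_simp; ring
    simp only [hθdef]
    constructor <;> linarith [h4.1, h4.2]
  have h34 : (3 : ℝ) / (2 * d) ≤ 3 / 4 := by
    refine div_le_div_of_nonneg_left (by norm_num) (by norm_num) (by linarith)
  have hθ : ∀ u : Fin m → ℝ, (∀ j, u j ∈ Set.Icc (0 : ℝ) 1) → ∀ i,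
      θ u i ∈ Set.Ioo (0 : ℝ) 1 := by
    intro u hu i
    have h := hθbd u hu i
    have : (0 : ℝ) < 1 / (2 * d) := by positivity
    exact ⟨by linarith [h.1], by linarith [h.2]⟩
  refine le_trans ?_ (minimaxRiskPublic_ge (n := n) (k := k) (simplexParameters d) θ D
    (by simp only [hθdef]; fun_prop) ?_ hθ ?_ (b := 16 / d * μ) (by positivity) ?_
    -- Since `θ u (lo j) = (1 / 2 + u j) / d`, the lower coordinate of a pair alone determines `u
    -- j`; the loss in the upper one is discarded.
    (fun a j => d * a (lo j) - 1 / 2) (by fun_prop) (κ := 1 / d ^ 2) (by positivity) ?_)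
  · refine ENNReal.ofReal_le_ofReal ?_
    have e : max ((d : ℝ) / (n * 2 ^ k)) (1 / n) = (d : ℝ) / (n * μ) := by
      have : (1 : ℝ) / n = (d : ℝ) / (n * d) := by field_simp
      rw [this, max_div_eq_div_min (by positivity) (by positivity) (by positivity), hμ,
        ← mul_min_of_nonneg _ _ hn0.le, min_comm]
    -- From `m ≤ d` and `d ^ 2 ≤ n * μ`. With `d ≤ 3 * m` the constant is `9 * 36 * 17 = 5508`.
    have h1 : (m : ℝ) + n * (16 / d * μ) ≤ 17 * (n * μ) / d := by
      rw [le_div_iff₀ hd0]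
      have : ((m : ℝ) + n * (16 / d * μ)) * d = m * d + 16 * (n * μ) := by field_simp
      rw [this]
      nlinarith
    have hm2 : (d : ℝ) ^ 2 ≤ 9 * m ^ 2 := by nlinarith
    calc 1 / 5508 * max ((d : ℝ) / (n * 2 ^ k)) (1 / n)
        = 1 / d ^ 2 * ((d ^ 2 / 9) / (36 * (17 * (n * μ) / d))) := by
          rw [e]; field_simp; norm_num
      _ ≤ 1 / d ^ 2 * (m ^ 2 / (36 * (m + n * (16 / d * μ)))) := by
          refine mul_le_mul_of_nonneg_left ?_ (by positivity)
          exact div_le_div₀ (by positivity) (by linarith) (by positivity) (by linarith)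
  · intro u j t i
    simp only [hθdef]
    have : ∀ j', D j' i * (Function.update u j t j' - 1 / 2)
        = D j' i * (u j' - 1 / 2) + if j' = j then (t - u j) * D j i else 0 := by
      intro j'
      by_cases h : j' = j
      · subst h; simp; ring
      · simp [h]
    simp only [this, Finset.sum_add_distrib, Finset.sum_ite_eq', Finset.mem_univ, if_true]
    ring
  · intro u hu ϑ hϑ
    simp only [simplexParameters, Set.mem_ofPred_eq, hϑ, hθdef]
    rw [Finset.sum_add_distrib, Finset.sum_comm]
    have : ∀ j, ∑ i, D j i * (u j - 1 / 2) = 0 := by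
      intro j
      rw [hDsum j fun _ => u j - 1 / 2]
      simp
    simp only [this, Finset.sum_const_zero, add_zero, Finset.sum_const, Finset.card_univ,
      Fintype.card_fin, nsmul_eq_mul]
    field_simp
  · intro u hu f hf
    have h1 : ∀ j x, ∑ i, D j i * coordScore (θ u) i x
        = 1 / d * (coordScore (θ u) (lo j) x - coordScore (θ u) (hi j) x) := by
      intro j x
      rw [hDsum j fun i => coordScore (θ u) i x]
      ring
    simp only [h1]
    refine (sum_fisherInfo_pairs_le (hθ u hu) (V := 8 * d) (by positivity) (fun i => ?_) he f hf
      (1 / d)).trans (le_of_eq ?_)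
    · obtain ⟨h1, h2⟩ := hθbd u hu i
      have h3 : (1 : ℝ) / (8 * d) ≤ θ u i * (1 - θ u i) := by
        calc (1 : ℝ) / (8 * d) = 1 / (2 * d) * (1 / 4) := by field_simp; norm_num
          _ ≤ _ := mul_le_mul h1 (by linarith) (by norm_num) (hθ u hu i).1.le
      refine (one_div_le_one_div_of_le (by positivity) h3).trans ?_
      rw [one_div_one_div]
    · rw [← hμ]; field_simp; norm_num
  · intro u a
    have h1 : ∀ j, θ u (lo j) = (1 / 2 + u j) / d := by
      intro j
      simp only [hθdef]
      rw [hDlo j fun j => u j - 1 / 2]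
      ring
    calc _ = ∑ j, (a (lo j) - θ u (lo j)) ^ 2 := by
          rw [Finset.mul_sum]
          refine Finset.sum_congr rfl fun j _ => ?_
          rw [h1]; field_simp; ring
      _ ≤ ∑ j, ((a (lo j) - θ u (lo j)) ^ 2 + (a (hi j) - θ u (hi j)) ^ 2) :=
          Finset.sum_le_sum fun j _ => le_add_of_nonneg_right (sq_nonneg _)
      _ ≤ _ := sum_comp_le_sum he (F := fun i => (a i - θ u i) ^ 2) fun i => sq_nonneg _

end LowerInstances

/-! ### Simultaneous protocols -/

section Simultaneous

variable {n k d : ℕ}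

/-- The protocol in which the sensors write one after the other, and sensor `i`, with sample `x`,
writes the string `e i x`. -/
def simultaneousProtocol {X : Type} (hn : 0 < n) (hk : 0 < k) (e : Fin n → X → Fin k → Bool) :
    BlackboardProtocol n k X where
  -- The default sensor is named only on boards of length at least `n * k`, when writing is over.
  speaker h := if hh : h.length / k < n then ⟨h.length / k, hh⟩ else ⟨0, hn⟩
  bit h x := e (if hh : h.length / k < n then ⟨h.length / k, hh⟩ else ⟨0, hn⟩) x
    ⟨h.length % k, Nat.mod_lt _ hk⟩
  budget y hy i := by
    have : ((Finset.range (n * k)).filter fun t =>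
        (if hh : (y.take t).length / k < n then (⟨(y.take t).length / k, hh⟩ : Fin n)
          else ⟨0, hn⟩) = i) = Finset.Ico (i * k) (i * k + k) := by
      ext t
      simp only [Finset.mem_filter, Finset.mem_range, Finset.mem_Ico, List.length_take, hy]
      have hi : (i : ℕ) * k + k ≤ n * k := by
        have := Nat.mul_le_mul_right k i.2
        rwa [Nat.succ_mul] at this
      constructor
      · rintro ⟨ht, h⟩
        have hlt : t / k < n := Nat.div_lt_of_lt_mul (by rwa [mul_comm])
        simp only [min_eq_left ht.le, dif_pos hlt] at h
        have h' : t / k = i := congrArg Fin.val h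
        rw [← h']
        exact ⟨Nat.div_mul_le_self t k, Nat.lt_div_mul_add hk⟩
      · rintro ⟨h1, h2⟩
        have ht : t < n * k := h2.trans_le hi
        have hlt : t / k < n := Nat.div_lt_of_lt_mul (by rwa [mul_comm])
        refine ⟨ht, ?_⟩
        simp only [min_eq_left ht.le, dif_pos hlt]
        apply Fin.ext
        exact Nat.div_eq_of_lt_le h1 (by rwa [Nat.succ_mul])
    rw [this]
    simp

theorem simultaneousProtocol_transcript {X : Type} (hn : 0 < n) (hk : 0 < k)
    (e : Fin n → X → Fin k → Bool) (x : Fin n → X) (i : Fin n) (r : Fin k) :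
    ((simultaneousProtocol hn hk e).transcript x).getD (i * k + r) false = e i (x i) r := by
  have hi : (i : ℕ) * k + r < n * k := by
    have := Nat.mul_le_mul_right k i.2
    rw [Nat.succ_mul] at this
    have := r.2
    omega
  have hdiv : ((i : ℕ) * k + r) / k = i := by
    rw [mul_comm, Nat.mul_add_div hk, Nat.div_eq_of_lt r.2, add_zero]
  have hmod : ((i : ℕ) * k + r) % k = r := by
    rw [mul_comm, Nat.mul_add_mod, Nat.mod_eq_of_lt r.2]
  rw [BlackboardProtocol.transcript, BlackboardProtocol.board_getD _ _ hi]
  simp only [simultaneousProtocol, BlackboardProtocol.board_length, hdiv, hmod, i.2, dif_pos]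

theorem exists_code {X W : Type*} [Fintype X] [Nonempty X] [DecidableEq W] (e : X → W)
    (he : (Finset.univ.image e).card ≤ 2 ^ k) :
    ∃ (c : X → Fin k → Bool) (dec : (Fin k → Bool) → W), ∀ x, dec (c x) = e x := by
  obtain ⟨x₀⟩ := ‹Nonempty X›
  obtain ⟨φ⟩ : Nonempty ((Finset.univ.image e : Finset W) ↪ (Fin k → Bool)) := by
    refine Function.Embedding.nonempty_of_card_le ?_
    simpa using he
  refine ⟨fun x => φ ⟨e x, Finset.mem_image_of_mem e (Finset.mem_univ x)⟩,
    Function.extend φ Subtype.val fun _ => e x₀, fun x => ?_⟩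
  rw [φ.injective.extend_apply]

/-- Upper bound for the minimax risk from estimators that see one message of each sensor, where
each sensor has at most `2 ^ k` messages. -/
theorem minimaxRisk_le {W : Type*} [DecidableEq W] (hn : 0 < n) (hk : 0 < k)
    (Θ : Set (Fin d → unitInterval)) (e : Fin n → (Fin d → Bool) → W)
    (he : ∀ i, (Finset.univ.image (e i)).card ≤ 2 ^ k) (g : (Fin n → W) → Fin d → ℝ) {R : ℝ}
    (hR : ∀ θ ∈ Θ, prodExp (fun _ => bernoulliProd fun i => (θ i : ℝ))
      (fun x => ∑ j, (g (fun i => e i (x i)) j - (θ j : ℝ)) ^ 2) ≤ R) :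
    blackboardMinimaxRisk n k Θ ≤ ENNReal.ofReal R := by
  choose c dec hdec using fun i => exists_code (k := k) (e i) (he i)
  let P : PublicCoinProtocol n k (Fin d → Bool) :=
    { Seed := Unit
      law := Measure.dirac ()
      protocol := fun _ => simultaneousProtocol hn hk c
      measurable_speaker := fun _ => measurable_const
      measurable_bit := fun _ _ => measurable_const }
  refine (iInf₂_le P fun y => g fun i => dec i fun r => y.getD (i * k + r) false).trans ?_
  refine iSup₂_le fun θ hθ => ?_
  simp only [blackboardRisk, squaredLoss, P, simultaneousProtocol_transcript]
  have : ∀ (i : Fin n) (x : Fin d → Bool), (dec i fun r => c i x r) = e i x := fun i x => hdec i x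
  simp only [this]
  rw [lintegral_dirac, lintegral_samples θ _ fun x => Finset.sum_nonneg fun j _ => sq_nonneg _]
  exact ENNReal.ofReal_le_ofReal (hR θ hθ)

/-- Because of this comparison, lower bounds are needed only with access to the seed and upper
bounds only without it. -/
theorem minimaxRiskPublic_le (Θ : Set (Fin d → unitInterval)) :
    blackboardMinimaxRiskPublic n k Θ ≤ blackboardMinimaxRisk n k Θ :=
  le_iInf fun P => le_iInf fun est =>
    (iInf_le _ P).trans ((iInf_le _ fun _ => est).trans (iInf_le _ fun _ => measurable_const))

/-- The sensors whose index is congruent to `g` modulo `B`. -/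
def residueGroup (n B g : ℕ) : Finset (Fin n) := Finset.univ.filter fun i => (i : ℕ) % B = g

theorem div_le_card_residueGroup {B g : ℕ} (hg : g < B) : n / B ≤ (residueGroup n B g).card := by
  have hlt : ∀ q : Fin (n / B), (q : ℕ) * B + g < n := by
    intro q
    have h1 := Nat.mul_le_mul_right B q.2
    rw [Nat.succ_mul] at h1
    have h2 := Nat.div_mul_le_self n B
    omega
  have := Finset.card_le_card_of_injOn (s := (Finset.univ : Finset (Fin (n / B))))
    (t := residueGroup n B g) (fun q => ⟨q * B + g, hlt q⟩) ?_ ?_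
  · simpa using this
  · intro q _
    simp [residueGroup, Nat.mod_eq_of_lt hg]
  · intro q _ q' _ h
    have hB : 0 < B := by omega
    simp only [Fin.mk.injEq, add_left_inj] at h
    exact Fin.ext (Nat.eq_of_mul_eq_mul_right hB h)

theorem two_mul_card_residueGroup_ge {B g : ℕ} (hg : g < B) (hB : B ≤ n) :
    (n : ℝ) ≤ 2 * B * (residueGroup n B g).card ∧ 1 ≤ (residueGroup n B g).card := by
  have hB0 : 0 < B := by omega
  have h1 := div_le_card_residueGroup (n := n) hg
  have h2 : 1 ≤ n / B := (Nat.one_le_div_iff hB0).2 hB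
  refine ⟨?_, h2.trans h1⟩
  have h3 : n ≤ 2 * B * (residueGroup n B g).card := by
    calc n ≤ B * (n / B) + B := by
          have := Nat.div_add_mod n B
          have := Nat.mod_lt n hB0
          omega
      _ ≤ 2 * B * (n / B) := by nlinarith
      _ ≤ _ := Nat.mul_le_mul_left _ h1
  exact_mod_cast h3

/-- The deviation of a Bernoulli variable from its mean. -/
def centered (t : ℝ) (b : Bool) : ℝ := (if b then 1 else 0) - t

theorem sum_bernoulliWeight_centered (t : ℝ) : ∑ b, bernoulliWeight t b * centered t b = 0 := by
  simp [bernoulliWeight, centered]; ring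

theorem sum_bernoulliWeight_centered_sq (t : ℝ) :
    ∑ b, bernoulliWeight t b * centered t b ^ 2 = t * (1 - t) := by
  simp [bernoulliWeight, centered]; ring

theorem ceil_div_le (d q : ℕ) :
    (((d - 1) / q + 1 : ℕ) : ℝ) ≤ d / q + 1 := by
  push_cast
  have h1 : (((d - 1) / q : ℕ) : ℝ) ≤ ((d - 1 : ℕ) : ℝ) / q := Nat.cast_div_le
  have h2 : ((d - 1 : ℕ) : ℝ) / q ≤ d / q := by
    refine div_le_div_of_nonneg_right ?_ (by positivity)
    exact_mod_cast Nat.sub_le d 1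
  linarith

/-- The mean of a coordinate over its group is unbiased with variance at most `2 * B / n`, where `B`
is the number of blocks of `k` coordinates. -/
theorem cube_minimaxRisk_le (hd : 1 ≤ d) (hk : 1 ≤ k)
    (hn : (d : ℝ) ^ 2 / min (d : ℝ) (k : ℝ) ≤ n) :
    blackboardMinimaxRisk n k (Set.univ : Set (Fin d → unitInterval)) ≤
      ENNReal.ofReal (4 * max ((d : ℝ) ^ 2 / (n * k)) ((d : ℝ) / n)) := by
  have hd1 : (1 : ℝ) ≤ d := by exact_mod_cast hd
  have hk1 : (1 : ℝ) ≤ k := by exact_mod_cast hk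
  have hdn : d ≤ n := by
    rw [div_le_iff₀ (lt_min (by linarith) (by linarith))] at hn
    have h1 : (n : ℝ) * min (d : ℝ) k ≤ n * d :=
      mul_le_mul_of_nonneg_left (min_le_left _ _) (Nat.cast_nonneg n)
    have h2 : (d : ℝ) * d ≤ n * d := by nlinarith
    exact_mod_cast le_of_mul_le_mul_right h2 (by linarith)
  have hn0 : 0 < n := by omega
  have hn0' : (0 : ℝ) < n := by exact_mod_cast hn0
  set B := (d - 1) / k + 1 with hB
  have hBn : B ≤ n := by
    have := Nat.div_le_self (d - 1) k
    omega
  have hjB : ∀ j : Fin d, (j : ℕ) / k < B := fun j =>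
    Nat.lt_succ_of_le (Nat.div_le_div_right (by omega))
  let I : Fin d → Finset (Fin n) := fun j => residueGroup n B (j / k)
  refine (minimaxRisk_le (W := Fin k → Bool) hn0 hk Set.univ
    -- The last block may extend beyond `d`; its superfluous bits are padded with `false`.
    (fun i x r => if h : (i : ℕ) % B * k + r < d then x ⟨_, h⟩ else false) (fun i => ?_)
    (fun w j => (∑ i ∈ I j, if w i ⟨j % k, Nat.mod_lt _ hk⟩ then (1 : ℝ) else 0) / (I j).card)
    (R := 2 * B * d / n) fun θ _ => ?_).trans (ENNReal.ofReal_le_ofReal ?_)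
  · exact (Finset.card_le_univ _).trans (by simp)
  · rw [prodExp_sum]
    have hprob : ∀ _r : Fin n, ∑ a, bernoulliProd (fun i => (θ i : ℝ)) a = 1 :=
      fun _ => sum_bernoulliProd _
    have hj : ∀ j : Fin d, prodExp (fun _ : Fin n => bernoulliProd fun i => (θ i : ℝ)) (fun x =>
        ((∑ i ∈ I j, if (if h : (i : ℕ) % B * k + j % k < d then x i ⟨_, h⟩ else false) = true
          then (1 : ℝ) else 0) / (I j).card - (θ j : ℝ)) ^ 2) ≤ 2 * B / n := by
      intro j
      obtain ⟨hN1, hN2⟩ := two_mul_card_residueGroup_ge (hjB j) hBn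
      change (n : ℝ) ≤ 2 * B * (I j).card at hN1
      have hN0 : (0 : ℝ) < (I j).card := by exact_mod_cast hN2
      have h1 : ∀ x : Fin n → Fin d → Bool,
          ((∑ i ∈ I j, if (if h : (i : ℕ) % B * k + j % k < d then x i ⟨_, h⟩ else false) = true
            then (1 : ℝ) else 0) / (I j).card - (θ j : ℝ)) ^ 2
          = (1 / ((I j).card : ℝ) ^ 2) * (∑ i ∈ I j, centered (θ j) (x i j)) ^ 2 := by
        intro x
        have h2 : ∀ i ∈ I j,
            (if (if h : (i : ℕ) % B * k + j % k < d then x i ⟨_, h⟩ else false) = true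
              then (1 : ℝ) else 0) = centered (θ j) (x i j) + θ j := by
          intro i hi
          have hi' : (i : ℕ) % B = j / k := (Finset.mem_filter.1 hi).2
          have hj' : (i : ℕ) % B * k + j % k = j := by
            rw [hi', mul_comm]; exact Nat.div_add_mod _ _
          rw [dif_pos (by rw [hj']; exact j.2)]
          have : (⟨(i : ℕ) % B * k + j % k, by rw [hj']; exact j.2⟩ : Fin d) = j := Fin.ext hj'
          rw [this, centered]
          ring
        rw [Finset.sum_congr rfl h2, Finset.sum_add_distrib, Finset.sum_const, nsmul_eq_mul]
        field_simp
        ring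
      simp only [h1]
      rw [prodExp_mul_left, prodExp_sq_sum hprob (fun a => centered (θ j) (a j)) fun _ => ?_]
      · have h3 : ∑ a, bernoulliProd (fun i => (θ i : ℝ)) a * centered (θ j) (a j) ^ 2
            = θ j * (1 - θ j) :=
          (prodExp_coord (fun _ => sum_bernoulliWeight _) j fun b => centered (θ j) b ^ 2).trans
            (sum_bernoulliWeight_centered_sq _)
        rw [h3, Finset.sum_const, nsmul_eq_mul]
        have h4 : (θ j : ℝ) * (1 - θ j) ≤ 1 := by nlinarith [(θ j).2.1, (θ j).2.2]
        calc _ = (θ j : ℝ) * (1 - θ j) / (I j).card := by field_simp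
          _ ≤ 1 / (I j).card := div_le_div_of_nonneg_right h4 hN0.le
          _ ≤ 2 * B / n := by
            rw [div_le_div_iff₀ hN0 hn0']
            linarith
      · exact (prodExp_coord (fun _ => sum_bernoulliWeight _) j (centered (θ j))).trans
          (sum_bernoulliWeight_centered _)
    refine (Finset.sum_le_sum fun j _ => hj j).trans (le_of_eq ?_)
    simp only [Finset.sum_const, Finset.card_univ, Fintype.card_fin, nsmul_eq_mul]
    ring
  · have hB' : (B : ℝ) ≤ d / k + 1 := ceil_div_le d k
    have h1 := le_max_left ((d : ℝ) ^ 2 / (n * k)) ((d : ℝ) / n)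
    have h2 := le_max_right ((d : ℝ) ^ 2 / (n * k)) ((d : ℝ) / n)
    calc 2 * (B : ℝ) * d / n ≤ 2 * (d / k + 1) * d / n := by gcongr
      _ = 2 * ((d : ℝ) ^ 2 / (n * k) + d / n) := by field_simp
      _ ≤ _ := by linarith

end Simultaneous

/-! ### Estimating a parameter in the simplex -/

section Simplex

variable {n k d : ℕ}

/-- The first one of the block `S` in the sample `x`, where the coordinates are visited in the
order of their ranks `π`. -/
def firstOne (π : Fin d → Fin d) (S : Finset (Fin d)) (x : Fin d → Bool) : WithTop (Fin d) :=
  ((S.filter fun l => x l = true).image π).min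

theorem card_image_firstOne_le (π : Fin d → Fin d) (S : Finset (Fin d)) :
    (Finset.univ.image (firstOne π S)).card ≤ S.card + 1 := by
  have : Finset.univ.image (firstOne π S)
      ⊆ insert ⊤ (S.image fun l => ((π l : Fin d) : WithTop (Fin d))) := by
    intro w hw
    obtain ⟨x, -, rfl⟩ := Finset.mem_image.1 hw
    rw [Finset.mem_insert]
    rcases h : firstOne π S x with _ | a
    · exact Or.inl rfl
    · right
      have ha := Finset.mem_of_min h
      obtain ⟨l, hl, rfl⟩ := Finset.mem_image.1 ha
      exact Finset.mem_image.2 ⟨l, (Finset.mem_filter.1 hl).1, rfl⟩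
  exact (Finset.card_le_card this).trans
    ((Finset.card_insert_le _ _).trans (Nat.add_le_add_right Finset.card_image_le 1))

/-- The indicator of the event that no one precedes the coordinate `j` in the block `S`. -/
def atRisk (π : Fin d → Fin d) (S : Finset (Fin d)) (j : Fin d) (x : Fin d → Bool) : ℝ :=
  if (π j : WithTop (Fin d)) ≤ firstOne π S x then 1 else 0

theorem le_firstOne_iff (π : Fin d → Fin d) (S : Finset (Fin d)) (j : Fin d) (x : Fin d → Bool) :
    (π j : WithTop (Fin d)) ≤ firstOne π S x ↔ ∀ l ∈ S, π l < π j → x l = false := by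
  rw [firstOne, Finset.le_min_iff]
  simp only [Finset.mem_image, Finset.mem_filter, forall_exists_index, and_imp]
  constructor
  · intro h l hl hlt
    by_contra hx
    exact absurd (h (π l) l hl (by simpa using hx) rfl) (by simpa using hlt)
  · rintro h _ l hl hx rfl
    by_contra hlt
    have := h l hl (by simpa using hlt)
    simp [hx] at this

theorem firstOne_eq_iff {π : Fin d → Fin d} (hπ : Function.Injective π) {S : Finset (Fin d)}
    {j : Fin d} (hj : j ∈ S) (x : Fin d → Bool) :
    (if firstOne π S x = (π j : WithTop (Fin d)) then (1 : ℝ) else 0)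
      = atRisk π S j x * if x j then 1 else 0 := by
  unfold atRisk
  by_cases hx : x j = true
  · have hle : firstOne π S x ≤ (π j : WithTop (Fin d)) :=
      Finset.min_le (Finset.mem_image_of_mem π (Finset.mem_filter.2 ⟨hj, hx⟩))
    have : firstOne π S x = (π j : WithTop (Fin d)) ↔ (π j : WithTop (Fin d)) ≤ firstOne π S x :=
      ⟨fun h => h.ge, fun h => le_antisymm hle h⟩
    simp only [this, hx, if_true, mul_one]
  · have : firstOne π S x ≠ (π j : WithTop (Fin d)) := by
      intro h
      obtain ⟨l, hl, hlj⟩ := Finset.mem_image.1 (Finset.mem_of_min h)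
      rw [hπ hlj] at hl
      exact hx (Finset.mem_filter.1 hl).2
    simp [this, hx]

/-- Only coordinates of strictly smaller rank decide whether `j` is reached, so this event is
independent of `x j`. Hence reports minus `θ j` times reaches is centered. -/
theorem atRisk_update (π : Fin d → Fin d) (S : Finset (Fin d)) (j : Fin d) (x : Fin d → Bool)
    (b : Bool) : atRisk π S j (Function.update x j b) = atRisk π S j x := by
  unfold atRisk
  simp only [le_firstOne_iff]
  have : (∀ l ∈ S, π l < π j → Function.update x j b l = false)
      ↔ ∀ l ∈ S, π l < π j → x l = false := by
    refine forall₂_congr fun l _ => imp_congr_right fun hlt => ?_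
    rw [Function.update_of_ne]
    rintro rfl
    exact lt_irrefl _ hlt
  simp only [this]

theorem atRisk_mem_Icc (π : Fin d → Fin d) (S : Finset (Fin d)) (j : Fin d) (x : Fin d → Bool) :
    atRisk π S j x ∈ Set.Icc (0 : ℝ) 1 := by
  unfold atRisk
  split_ifs <;> simp

/-- The probability that no one precedes the coordinate `j` in the block `S`. -/
def survival (θ : Fin d → ℝ) (π : Fin d → Fin d) (S : Finset (Fin d)) (j : Fin d) : ℝ :=
  ∑ x, bernoulliProd θ x * atRisk π S j x

variable {θ : Fin d → ℝ}

theorem survival_mem_Icc (hθ : ∀ i, θ i ∈ Set.Icc (0 : ℝ) 1) (π : Fin d → Fin d)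
    (S : Finset (Fin d)) (j : Fin d) : survival θ π S j ∈ Set.Icc (0 : ℝ) 1 := by
  refine ⟨Finset.sum_nonneg fun x _ =>
    mul_nonneg (bernoulliProd_nonneg hθ x) (atRisk_mem_Icc π S j x).1, ?_⟩
  rw [← sum_bernoulliProd θ]
  exact Finset.sum_le_sum fun x _ =>
    mul_le_of_le_one_right (bernoulliProd_nonneg hθ x) (atRisk_mem_Icc π S j x).2

/-- A union bound over the coordinates visited before `j`. -/
theorem one_sub_sum_le_survival (hθ : ∀ i, θ i ∈ Set.Icc (0 : ℝ) 1) (π : Fin d → Fin d)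
    (S : Finset (Fin d)) (j : Fin d) :
    1 - ∑ l with π l < π j, θ l ≤ survival θ π S j := by
  have h1 : ∀ x : Fin d → Bool,
      1 - ∑ l with π l < π j, (if x l then (1 : ℝ) else 0) ≤ atRisk π S j x := by
    intro x
    have h0 : ∀ l ∈ Finset.univ.filter fun l => π l < π j, (0 : ℝ) ≤ if x l then 1 else 0 :=
      fun l _ => by split_ifs <;> norm_num
    unfold atRisk
    split_ifs with h
    · linarith [Finset.sum_nonneg h0]
    · rw [le_firstOne_iff] at h
      push Not at h
      obtain ⟨l, -, hlt, hx⟩ := h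
      have := Finset.single_le_sum h0 (Finset.mem_filter.2 ⟨Finset.mem_univ l, hlt⟩)
      simp only [Bool.not_eq_false] at hx
      rw [if_pos hx] at this
      linarith
  have h2 := prodExp_mono (p := fun i => bernoulliWeight (θ i))
    (fun i b => bernoulliWeight_nonneg (hθ i) b) h1
  refine le_trans (le_of_eq ?_) h2
  have h3 : ∀ x : Fin d → Bool, 1 - ∑ l with π l < π j, (if x l then (1 : ℝ) else 0)
      = 1 + (-1) * ∑ l with π l < π j, (if x l then (1 : ℝ) else 0) := fun x => by ring
  simp only [h3]
  rw [prodExp_add, prodExp_one fun _ => sum_bernoulliWeight _, prodExp_mul_left, prodExp_sum]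
  have h4 : ∀ l, prodExp (fun i => bernoulliWeight (θ i))
      (fun x => if x l then (1 : ℝ) else 0) = θ l := by
    intro l
    rw [prodExp_coord (fun _ => sum_bernoulliWeight _) l fun b => if b then (1 : ℝ) else 0]
    simp [bernoulliWeight]
  simp only [h4]
  ring

/-- One of the two visiting orders reaches `j` with probability at least one half. -/
theorem half_le_survival (hθ : ∀ i, θ i ∈ Set.Icc (0 : ℝ) 1) (hsum : ∑ i, θ i = 1)
    (S : Finset (Fin d)) (j : Fin d) :
    1 / 2 ≤ survival θ id S j ∨ 1 / 2 ≤ survival θ Fin.rev S j := by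
  have h1 := one_sub_sum_le_survival hθ id S j
  have h2 := one_sub_sum_le_survival hθ Fin.rev S j
  -- The predecessors of `j` in the two orders are disjoint sets, of total mass at most one.
  have h3 : ∑ l with id l < id j, θ l + ∑ l with Fin.rev l < Fin.rev j, θ l ≤ 1 := by
    rw [← hsum, ← Finset.sum_union]
    · exact Finset.sum_le_sum_of_subset_of_nonneg (Finset.subset_univ _) fun i _ _ => (hθ i).1
    · rw [Finset.disjoint_filter]
      intro l _ hl
      simp only [id, Fin.rev_lt_rev] at hl ⊢
      exact hl.not_gt
  by_contra h
  push Not at h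
  linarith [h.1, h.2]

theorem sum_atRisk_centered (π : Fin d → Fin d) (S : Finset (Fin d)) (j : Fin d) :
    ∑ x, bernoulliProd θ x * (atRisk π S j x * centered (θ j) (x j)) = 0 := by
  have := prodExp_mul_coord (p := fun i => bernoulliWeight (θ i)) j (sum_bernoulliWeight _)
    (atRisk π S j) (atRisk_update π S j) (centered (θ j))
  rw [sum_bernoulliWeight_centered, mul_zero] at this
  exact this

theorem sum_atRisk_centered_sq_le (hθ : ∀ i, θ i ∈ Set.Icc (0 : ℝ) 1) (π : Fin d → Fin d)
    (S : Finset (Fin d)) (j : Fin d) :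
    ∑ x, bernoulliProd θ x * (atRisk π S j x * centered (θ j) (x j)) ^ 2 ≤ θ j := by
  have h1 := prodExp_mono (p := fun i => bernoulliWeight (θ i))
    (fun i b => bernoulliWeight_nonneg (hθ i) b)
    (g := fun x => (atRisk π S j x * centered (θ j) (x j)) ^ 2)
    (h := fun x => centered (θ j) (x j) ^ 2) fun x => by
      rw [mul_pow]
      obtain ⟨h0, h1⟩ := atRisk_mem_Icc π S j x
      exact mul_le_of_le_one_left (sq_nonneg _) (pow_le_one₀ h0 h1)
  refine h1.trans ?_
  rw [prodExp_coord (fun _ => sum_bernoulliWeight _) j fun b => centered (θ j) b ^ 2,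
    sum_bernoulliWeight_centered_sq]
  nlinarith [(hθ j).1, (hθ j).2]

theorem sum_atRisk_sub_survival (π : Fin d → Fin d) (S : Finset (Fin d)) (j : Fin d) :
    ∑ x, bernoulliProd θ x * (atRisk π S j x - survival θ π S j) = 0 := by
  simp only [mul_sub, Finset.sum_sub_distrib, ← Finset.sum_mul, sum_bernoulliProd, one_mul]
  exact sub_self _

theorem sum_atRisk_sub_survival_sq_le (hθ : ∀ i, θ i ∈ Set.Icc (0 : ℝ) 1) (π : Fin d → Fin d)
    (S : Finset (Fin d)) (j : Fin d) :
    ∑ x, bernoulliProd θ x * (atRisk π S j x - survival θ π S j) ^ 2 ≤ 1 := by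
  rw [← sum_bernoulliProd θ]
  refine Finset.sum_le_sum fun x _ => mul_le_of_le_one_right (bernoulliProd_nonneg hθ x) ?_
  obtain ⟨h0, h1⟩ := atRisk_mem_Icc π S j x
  obtain ⟨h2, h3⟩ := survival_mem_Icc hθ π S j
  rw [sq_le_one_iff_abs_le_one, abs_le]
  constructor <;> linarith

/-- The ratio `H / M` of the first order in which a quarter of the `N` sensors reach the
coordinate. -/
def ratioEstimate (N₁ M₁ H₁ N₂ M₂ H₂ : ℝ) : ℝ :=
  if N₁ / 4 ≤ M₁ then H₁ / M₁ else if N₂ / 4 ≤ M₂ then H₂ / M₂ else 0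

/-- If an order with `N / 4 ≤ M` is used, the error is `(H - t * M) / M`. If neither qualifies, the
one with `s ≥ 1 / 2` deviates by at least `N / 4` from its mean, and `t ^ 2 ≤ t` keeps the factor
`t` in this Chebyshev-type bound. -/
theorem ratioEstimate_sub_sq_le {N₁ M₁ H₁ N₂ M₂ H₂ t s₁ s₂ : ℝ} (hN₁ : 0 < N₁) (hN₂ : 0 < N₂)
    (ht : t ∈ Set.Icc (0 : ℝ) 1) (hs : 1 / 2 ≤ s₁ ∨ 1 / 2 ≤ s₂) :
    (ratioEstimate N₁ M₁ H₁ N₂ M₂ H₂ - t) ^ 2 ≤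
      16 / N₁ ^ 2 * (H₁ - t * M₁) ^ 2 + 16 / N₂ ^ 2 * (H₂ - t * M₂) ^ 2
        + (16 * t / N₁ ^ 2 * (M₁ - N₁ * s₁) ^ 2 + 16 * t / N₂ ^ 2 * (M₂ - N₂ * s₂) ^ 2) := by
  have ht0 := ht.1
  have a1 : 0 ≤ 16 / N₁ ^ 2 * (H₁ - t * M₁) ^ 2 := by positivity
  have a2 : 0 ≤ 16 / N₂ ^ 2 * (H₂ - t * M₂) ^ 2 := by positivity
  have a3 : 0 ≤ 16 * t / N₁ ^ 2 * (M₁ - N₁ * s₁) ^ 2 := by positivity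
  have a4 : 0 ≤ 16 * t / N₂ ^ 2 * (M₂ - N₂ * s₂) ^ 2 := by positivity
  have hratio : ∀ {N M H : ℝ}, 0 < N → N / 4 ≤ M →
      (H / M - t) ^ 2 ≤ 16 / N ^ 2 * (H - t * M) ^ 2 := by
    intro N M H hN hM
    have hM0 : 0 < M := by linarith
    have e : (H / M - t) ^ 2 = (H - t * M) ^ 2 / M ^ 2 := by field_simp
    rw [e, div_le_iff₀ (by positivity)]
    have : 1 ≤ 16 / N ^ 2 * M ^ 2 := by
      rw [div_mul_eq_mul_div, one_le_div (by positivity)]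
      nlinarith
    nlinarith [mul_le_mul_of_nonneg_right this (sq_nonneg (H - t * M))]
  have hdev : ∀ {N M s : ℝ}, 0 < N → M < N / 4 → 1 / 2 ≤ s →
      t ^ 2 ≤ 16 * t / N ^ 2 * (M - N * s) ^ 2 := by
    intro N M s hN hM hs
    have h1 : N / 4 ≤ N * s - M := by nlinarith
    have h2 : 1 ≤ 16 / N ^ 2 * (M - N * s) ^ 2 := by
      rw [div_mul_eq_mul_div, one_le_div (by positivity)]
      nlinarith
    calc t ^ 2 ≤ t * 1 := by nlinarith [ht.2]
      _ ≤ t * (16 / N ^ 2 * (M - N * s) ^ 2) := mul_le_mul_of_nonneg_left h2 ht0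
      _ = _ := by ring
  unfold ratioEstimate
  split_ifs with h1 h2
  · linarith [hratio (H := H₁) hN₁ h1]
  · linarith [hratio (H := H₂) hN₂ h2]
  · rw [zero_sub, neg_sq]
    rcases hs with hs | hs
    · linarith [hdev hN₁ (not_le.1 h1) hs]
    · linarith [hdev hN₂ (not_le.1 h2) hs]

/-- The number of sensors in `I` that reach the coordinate `j`. -/
def reachCount (π : Fin d → Fin d) (j : Fin d) (I : Finset (Fin n))
    (w : Fin n → WithTop (Fin d)) : ℝ :=
  ∑ i ∈ I, if (π j : WithTop (Fin d)) ≤ w i then 1 else 0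

/-- The number of sensors in `I` that report the coordinate `j`. -/
def reportCount (π : Fin d → Fin d) (j : Fin d) (I : Finset (Fin n))
    (w : Fin n → WithTop (Fin d)) : ℝ :=
  ∑ i ∈ I, if w i = (π j : WithTop (Fin d)) then 1 else 0

/-- The mean squared error of `ratioEstimate`, when the sensors of `I₁` visit the block `S` in
ascending order and those of `I₂` in descending order. -/
theorem prodExp_ratioEstimate_le (hθ : ∀ i, θ i ∈ Set.Icc (0 : ℝ) 1) (hsum : ∑ i, θ i = 1)
    {S : Finset (Fin d)} {j : Fin d} (hj : j ∈ S) (e : Fin n → (Fin d → Bool) → WithTop (Fin d))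
    (I₁ I₂ : Finset (Fin n)) (he₁ : ∀ i ∈ I₁, e i = firstOne id S)
    (he₂ : ∀ i ∈ I₂, e i = firstOne Fin.rev S) (h₁ : 1 ≤ I₁.card) (h₂ : 1 ≤ I₂.card) :
    prodExp (fun _ => bernoulliProd θ) (fun x =>
      (ratioEstimate I₁.card (reachCount id j I₁ fun i => e i (x i))
        (reportCount id j I₁ fun i => e i (x i)) I₂.card
        (reachCount Fin.rev j I₂ fun i => e i (x i))
        (reportCount Fin.rev j I₂ fun i => e i (x i)) - θ j) ^ 2)
      ≤ 32 * θ j * (1 / I₁.card + 1 / I₂.card) := by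
  have hN₁ : (0 : ℝ) < I₁.card := by exact_mod_cast h₁
  have hN₂ : (0 : ℝ) < I₂.card := by exact_mod_cast h₂
  have ht := hθ j
  have ht0 := ht.1
  have hp : ∀ _i : Fin n, ∑ a, bernoulliProd θ a = 1 := fun _ => sum_bernoulliProd θ
  have hreach : ∀ (π : Fin d → Fin d) (I : Finset (Fin n)), (∀ i ∈ I, e i = firstOne π S) →
      ∀ x : Fin n → Fin d → Bool,
      reachCount π j I (fun i => e i (x i)) = ∑ i ∈ I, atRisk π S j (x i) := by
    intro π I he x
    exact Finset.sum_congr rfl fun i hi => by simp only [he i hi]; rfl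
  have hD : ∀ (π : Fin d → Fin d), Function.Injective π → ∀ (I : Finset (Fin n)),
      (∀ i ∈ I, e i = firstOne π S) → ∀ x : Fin n → Fin d → Bool,
      reportCount π j I (fun i => e i (x i)) - θ j * reachCount π j I (fun i => e i (x i))
        = ∑ i ∈ I, atRisk π S j (x i) * centered (θ j) (x i j) := by
    intro π hπ I he x
    rw [hreach π I he, Finset.mul_sum, reportCount, ← Finset.sum_sub_distrib]
    refine Finset.sum_congr rfl fun i hi => ?_
    rw [he i hi, firstOne_eq_iff hπ hj, centered]
    ring
  have hM : ∀ (π : Fin d → Fin d) (I : Finset (Fin n)), (∀ i ∈ I, e i = firstOne π S) →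
      ∀ x : Fin n → Fin d → Bool,
      reachCount π j I (fun i => e i (x i)) - I.card * survival θ π S j
        = ∑ i ∈ I, (atRisk π S j (x i) - survival θ π S j) := by
    intro π I he x
    rw [hreach π I he, Finset.sum_sub_distrib, Finset.sum_const, nsmul_eq_mul]
  have hED : ∀ (π : Fin d → Fin d) (I : Finset (Fin n)), prodExp (fun _ => bernoulliProd θ)
      (fun x => (∑ i ∈ I, atRisk π S j (x i) * centered (θ j) (x i j)) ^ 2) ≤ I.card * θ j := by
    intro π I
    rw [prodExp_sq_sum hp (fun a => atRisk π S j a * centered (θ j) (a j))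
      (fun _ => sum_atRisk_centered π S j), Finset.sum_const, nsmul_eq_mul]
    exact mul_le_mul_of_nonneg_left (sum_atRisk_centered_sq_le hθ π S j) (Nat.cast_nonneg _)
  have hEM : ∀ (π : Fin d → Fin d) (I : Finset (Fin n)), prodExp (fun _ => bernoulliProd θ)
      (fun x => (∑ i ∈ I, (atRisk π S j (x i) - survival θ π S j)) ^ 2) ≤ I.card := by
    intro π I
    rw [prodExp_sq_sum hp (fun a => atRisk π S j a - survival θ π S j)
      (fun _ => sum_atRisk_sub_survival π S j), Finset.sum_const, nsmul_eq_mul]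
    exact mul_le_of_le_one_right (Nat.cast_nonneg _) (sum_atRisk_sub_survival_sq_le hθ π S j)
  refine (prodExp_mono (fun _ => bernoulliProd_nonneg hθ) fun x =>
    ratioEstimate_sub_sq_le hN₁ hN₂ ht (half_le_survival hθ hsum S j)).trans ?_
  simp only [hD id Function.injective_id I₁ he₁, hD Fin.rev Fin.rev_injective I₂ he₂,
    hM id I₁ he₁, hM Fin.rev I₂ he₂]
  simp only [prodExp_add, prodExp_mul_left]
  have b1 := mul_le_mul_of_nonneg_left (hED id I₁)
    (by positivity : (0 : ℝ) ≤ 16 / (I₁.card : ℝ) ^ 2)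
  have b2 := mul_le_mul_of_nonneg_left (hED Fin.rev I₂)
    (by positivity : (0 : ℝ) ≤ 16 / (I₂.card : ℝ) ^ 2)
  have b3 := mul_le_mul_of_nonneg_left (hEM id I₁)
    (by positivity : (0 : ℝ) ≤ 16 * θ j / (I₁.card : ℝ) ^ 2)
  have b4 := mul_le_mul_of_nonneg_left (hEM Fin.rev I₂)
    (by positivity : (0 : ℝ) ≤ 16 * θ j / (I₂.card : ℝ) ^ 2)
  -- For each order, `16 / N ^ 2 * (N * θ j) + 16 * θ j / N ^ 2 * N = 32 * θ j / N`.
  refine (add_le_add (add_le_add b1 b2) (add_le_add b3 b4)).trans (le_of_eq ?_)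
  field_simp
  ring

theorem simplex_minimaxRisk_le_one (hn : 0 < n) (hk : 0 < k) :
    blackboardMinimaxRisk n k (simplexParameters d) ≤ ENNReal.ofReal 1 := by
  refine minimaxRisk_le (W := Unit) hn hk _ (fun _ _ => ()) (fun i => ?_) (fun _ _ => 0)
    fun θ hθ => ?_
  · exact (Finset.card_le_univ _).trans (by simpa using Nat.one_le_two_pow)
  · rw [prodExp_const fun _ => sum_bernoulliProd _]
    have h1 : ∑ j, (θ j : ℝ) = 1 := hθ
    rw [← h1]
    refine Finset.sum_le_sum fun j _ => ?_
    nlinarith [(θ j).2.1, (θ j).2.2]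

theorem simplex_minimaxRisk_le (hd : 1 ≤ d) (hn : 0 < n) (hk : 1 ≤ k) :
    blackboardMinimaxRisk n k (simplexParameters d) ≤
      ENNReal.ofReal (768 * max ((d : ℝ) / (n * 2 ^ k)) (1 / n)) := by
  have hn' : (0 : ℝ) < n := by exact_mod_cast hn
  have hpow : 2 ≤ 2 ^ k := by
    calc 2 = 2 ^ 1 := rfl
      _ ≤ 2 ^ k := Nat.pow_le_pow_right (by norm_num) hk
  have hq : 0 < 2 ^ k - 1 := by omega
  -- One of the `2 ^ k` messages is reserved for a block without ones.
  set q := 2 ^ k - 1 with hqdef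
  set B := (d - 1) / q + 1 with hBdef
  have hB0 : 0 < B := Nat.succ_pos _
  have hmax1 := le_max_left ((d : ℝ) / (n * 2 ^ k)) (1 / n)
  have hmax2 := le_max_right ((d : ℝ) / (n * 2 ^ k)) (1 / n)
  have hBn : (B : ℝ) / n ≤ 3 * max ((d : ℝ) / (n * 2 ^ k)) (1 / n) := by
    have h1 : (B : ℝ) ≤ d / q + 1 := ceil_div_le d q
    have hq' : (2 : ℝ) ^ k ≤ 2 * q := by
      have : 2 ^ k ≤ 2 * q := by omega
      exact_mod_cast this
    have h2 : (d : ℝ) / q ≤ 2 * (d / 2 ^ k) := by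
      rw [← mul_div_assoc, div_le_div_iff₀ (by exact_mod_cast hq) (by positivity)]
      nlinarith [(Nat.cast_nonneg d : (0 : ℝ) ≤ d)]
    calc (B : ℝ) / n ≤ (2 * (d / 2 ^ k) + 1) / n := by gcongr; linarith
      _ = 2 * (d / (n * 2 ^ k)) + 1 / n := by field_simp
      _ ≤ _ := by linarith
  -- If there are fewer sensors than groups, then `1 ≤ 2 * B / n`, and the zero estimate is good
  -- enough.
  rcases lt_or_ge n (2 * B) with hlt | hge
  · refine (simplex_minimaxRisk_le_one hn hk).trans (ENNReal.ofReal_le_ofReal ?_)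
    have h1 : (1 : ℝ) ≤ 2 * (B / n) := by
      rw [← mul_div_assoc, one_le_div hn']
      exact_mod_cast hlt.le
    linarith
  let S : ℕ → Finset (Fin d) := fun b => Finset.univ.filter fun j => (j : ℕ) / q = b
  have hS : ∀ b, (S b).card ≤ q := by
    intro b
    have := Finset.card_le_card_of_injOn (s := S b) (t := Finset.range q)
      (fun j => (j : ℕ) % q) (fun j _ => by simpa using Nat.mod_lt _ hq) ?_
    · simpa using this
    · intro i hi j hj hij
      have hi' : (i : ℕ) / q = b := (Finset.mem_filter.1 hi).2
      have hj' : (j : ℕ) / q = b := (Finset.mem_filter.1 hj).2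
      apply Fin.ext
      rw [← Nat.div_add_mod (i : ℕ) q, ← Nat.div_add_mod (j : ℕ) q, hi', hj']
      exact congrArg _ hij
  let π : ℕ → Fin d → Fin d := fun r => if r = 0 then id else Fin.rev
  -- The residue `2 * b + r` modulo `2 * B` assigns a sensor to block `b` and direction `r`.
  let e : Fin n → (Fin d → Bool) → WithTop (Fin d) := fun i =>
    firstOne (π ((i : ℕ) % (2 * B) % 2)) (S ((i : ℕ) % (2 * B) / 2))
  let I : Fin d → ℕ → Finset (Fin n) := fun j r => residueGroup n (2 * B) (2 * (j / q) + r)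
  have hI : ∀ j : Fin d, ∀ r < 2, (n : ℝ) ≤ 4 * B * (I j r).card ∧ 1 ≤ (I j r).card := by
    intro j r hr
    have hjB : (j : ℕ) / q < B := Nat.lt_succ_of_le (Nat.div_le_div_right (by omega))
    obtain ⟨h1, h2⟩ := two_mul_card_residueGroup_ge (g := 2 * (j / q) + r) (by omega) hge
    refine ⟨h1.trans (le_of_eq ?_), h2⟩
    push_cast
    ring
  have heI : ∀ j : Fin d, ∀ r < 2, ∀ i ∈ I j r, e i = firstOne (π r) (S (j / q)) := by
    intro j r hr i hi
    have hi' : (i : ℕ) % (2 * B) = 2 * (j / q) + r := (Finset.mem_filter.1 hi).2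
    have h1 : (2 * ((j : ℕ) / q) + r) % 2 = r := by omega
    have h2 : (2 * ((j : ℕ) / q) + r) / 2 = j / q := by omega
    simp only [e, hi', h1, h2]
  refine (minimaxRisk_le hn hk _ e (fun i => ?_) (fun w j =>
    ratioEstimate (I j 0).card (reachCount id j (I j 0) w) (reportCount id j (I j 0) w)
      (I j 1).card (reachCount Fin.rev j (I j 1) w) (reportCount Fin.rev j (I j 1) w))
    (R := 256 * (B / n)) fun θ hθ => ?_).trans (ENNReal.ofReal_le_ofReal (by linarith))
  · refine (card_image_firstOne_le _ _).trans ?_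
    have := hS ((i : ℕ) % (2 * B) / 2)
    omega
  · have hsum : ∑ j, (θ j : ℝ) = 1 := hθ
    rw [prodExp_sum]
    calc _ ≤ ∑ j, 32 * (θ j : ℝ) * (1 / (I j 0).card + 1 / (I j 1).card) :=
          Finset.sum_le_sum fun j _ => prodExp_ratioEstimate_le (fun i => (θ i).2) hsum
            (S := S (j / q)) (Finset.mem_filter.2 ⟨Finset.mem_univ j, rfl⟩) e _ _
            (heI j 0 two_pos) (heI j 1 one_lt_two) (hI j 0 two_pos).2 (hI j 1 one_lt_two).2
      _ ≤ ∑ j, 256 * (B / n) * (θ j : ℝ) := by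
          refine Finset.sum_le_sum fun j _ => ?_
          -- Each group has at least `n / (4 * B)` sensors, whence `32 * (4 + 4) = 256`.
          have h1 : ∀ r < 2, (1 : ℝ) / (I j r).card ≤ 4 * (B / n) := by
            intro r hr
            obtain ⟨h1, h2⟩ := hI j r hr
            have : (0 : ℝ) < (I j r).card := by exact_mod_cast h2
            rw [← mul_div_assoc, div_le_div_iff₀ this hn']
            linarith
          have h2 := mul_le_mul_of_nonneg_left (add_le_add (h1 0 two_pos) (h1 1 one_lt_two))
            (mul_nonneg (by norm_num) (θ j).2.1 : (0 : ℝ) ≤ 32 * θ j)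
          linarith
      _ = 256 * (B / n) := by rw [← Finset.mul_sum, hsum, mul_one]

end Simplex

end

/-! ### The two minimax rates -/

theorem proposition2 :
    (∃ c C : ℝ, 0 < c ∧ 0 < C ∧ ∀ d k n : ℕ, 1 ≤ d → 1 ≤ k →
      (d : ℝ) ^ 2 / min (d : ℝ) (k : ℝ) ≤ (n : ℝ) →
        BetweenMultiples c C (max ((d : ℝ) ^ 2 / ((n : ℝ) * (k : ℝ))) ((d : ℝ) / (n : ℝ)))
          (blackboardMinimaxRisk n k (Set.univ : Set (Fin d → unitInterval))) ∧
        BetweenMultiples c C (max ((d : ℝ) ^ 2 / ((n : ℝ) * (k : ℝ))) ((d : ℝ) / (n : ℝ)))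
          (blackboardMinimaxRiskPublic n k (Set.univ : Set (Fin d → unitInterval)))) ∧
    (∃ c C : ℝ, 0 < c ∧ 0 < C ∧ ∀ d k n : ℕ, 2 ≤ d → 1 ≤ k →
      (d : ℝ) ^ 2 / min (d : ℝ) ((2 : ℝ) ^ k) ≤ (n : ℝ) →
        BetweenMultiples c C (max ((d : ℝ) / ((n : ℝ) * (2 : ℝ) ^ k)) (1 / (n : ℝ)))
          (blackboardMinimaxRisk n k (simplexParameters d)) ∧
        BetweenMultiples c C (max ((d : ℝ) / ((n : ℝ) * (2 : ℝ) ^ k)) (1 / (n : ℝ)))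
          (blackboardMinimaxRiskPublic n k (simplexParameters d))) := by
  refine ⟨⟨1 / 1296, 4, by norm_num, by norm_num, fun d k n hd hk hn => ?_⟩,
    ⟨1 / 5508, 768, by norm_num, by norm_num, fun d k n hd hk hn => ?_⟩⟩
  · have hl := cube_minimaxRisk_ge hd hk hn
    have hu := cube_minimaxRisk_le hd hk hn
    have hlu := minimaxRiskPublic_le (n := n) (k := k) (Set.univ : Set (Fin d → unitInterval))
    exact ⟨⟨hl.trans hlu, hu⟩, ⟨hl, hlu.trans hu⟩⟩
  · have hn0 : 0 < n := by
      have h1 : (0 : ℝ) < (d : ℝ) ^ 2 / min (d : ℝ) ((2 : ℝ) ^ k) := by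
        have : (0 : ℝ) < d := by exact_mod_cast (by omega : 0 < d)
        exact div_pos (by positivity) (lt_min this (by positivity))
      exact_mod_cast h1.trans_le hn
    have hl := simplex_minimaxRisk_ge hd hn
    have hu := simplex_minimaxRisk_le (d := d) (by omega) hn0 hk
    have hlu := minimaxRiskPublic_le (n := n) (k := k) (simplexParameters d)
    exact ⟨⟨hl.trans hlu, hu⟩, ⟨hl, hlu.trans hu⟩⟩
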